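/- There is an absolute constant $C_2>0$ such that the following holds. Let $d\ge 3$ be an odd integer and $L\ge 1$ an integer. Let $\epsilon$ be a real random variable with $\mathbb E[\epsilon]=\mathbb E[\epsilon^3]=0$, $|\epsilon|\le b$ almost surely for some $b>0$, $\nu:=\mathbb E[\epsilon^2]>0$ and $\mathbb E[\epsilon^4]=2\nu^2$. Let $\epsilon_{l,i}$ ($1\le l\le L$, $1\le i\le d$) be independent copies of $\epsilon$, and let $D_l=\sum_{i=1}^d\epsilon_{l,i}e_ie_i^*$, where $e_1,\dots,e_d$ is the standard basis of $\mathbb C^d$. Put $f_k=\sum_{j=1}^d\omega^{jk}e_j$ with $\omega=\exp(2\pi i/d)$, and $F_{k,l}=D_lf_kf_k^*D_l$ for $1\le k\le d$. Let $x\in\mathbb C^d$ with $\|x\|_{\ell_2}=1$, $X=xx^*$, $T=\{xz^*+zx^*: z\in\mathbb C^d\}$, and let $\mathcal P_T^\perp(W)=W-(XW+WX-XWX)$ be the projection of the hermitian $d\times d$ matrices onto the orthocomplement of $T$ with respect to the Frobenius inner product. Write $\|\cdot\|_2$ for the Frobenius norm and $\|\cdot\|_\infty$ for the operator norm. Let $\gamma=8+\log_2(b^2/\nu)$.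 For a fixed $Z\in T$, $Z\ne 0$, let $$U_{k,l}=\bigl\{|\mathrm{tr}(F_{k,l}Z)|\le 2^{3/2}\,b^2\,\gamma\,\log d\;\|Z\|_2\bigr\},\qquad \mathcal R_Z(W)=\sum_{l=1}^L\frac1{\nu^2dL}\sum_{k=1}^d 1_{U_{k,l}}\,F_{k,l}\,\mathrm{tr}(F_{k,l}W).$$ Then for every $t\ge 1/4$, $$\Pr\Bigl[\bigl\|\mathcal P_T^\perp\bigl(\mathcal R_Z(Z)-\mathrm{tr}(Z)\,\mathrm{Id}\bigr)\bigr\|_\infty\ge t\,\|Z\|_2\Bigr]\le d\,\exp\Bigl(-\frac{t\,\nu^4L}{C_2\,b^8\,\gamma\,\log d}\Bigr).$$ -/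

import Mathlib

open MeasureTheory ProbabilityTheory

noncomputable section

namespace CodedDiffraction

section FrobeniusNorm

open scoped Matrix.Norms.Frobenius

/-- The Frobenius norm `‖Z‖₂`, i.e. `√(tr (Z²))` for hermitian `Z`. -/
def frobNorm {d : ℕ} (Z : Matrix (Fin d) (Fin d) ℂ) : ℝ := ‖Z‖

end FrobeniusNorm

section OperatorNorm

open scoped Matrix.Norms.L2Operator

/-- The operator norm `‖Z‖_∞` with respect to the Euclidean norm on `ℂ^d`. -/
def opNorm {d : ℕ} (Z : Matrix (Fin d) (Fin d) ℂ) : ℝ := ‖Z‖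

end OperatorNorm

/-- The matrix `u v^*`. -/
def outer {d : ℕ} (u v : Fin d → ℂ) : Matrix (Fin d) (Fin d) ℂ :=
  Matrix.vecMulVec u (star v)

/-- The discrete Fourier vector `f_k = ∑_j ω^(jk) e_j` with `ω = exp (2πi/d)`. The elements
`0, …, d - 1` of `Fin d` stand for the indices `1, …, d`. -/
def fourierVec (d : ℕ) (k : Fin d) : Fin d → ℂ := fun j =>
  Complex.exp (2 * Real.pi * Complex.I / d) ^ (((j : ℕ) + 1) * ((k : ℕ) + 1))

/-- The diagonal matrix `D` of a modulation pattern `a`. -/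
def maskMatrix {d : ℕ} (a : Fin d → ℝ) : Matrix (Fin d) (Fin d) ℂ :=
  Matrix.diagonal fun i => (a i : ℂ)

/-- The measurement matrix `F_k = D f_k f_k^* D` of a modulation pattern `a`. -/
def measMatrix {d : ℕ} (a : Fin d → ℝ) (k : Fin d) : Matrix (Fin d) (Fin d) ℂ :=
  maskMatrix a * outer (fourierVec d k) (fourierVec d k) * maskMatrix a

/-- The space `T = {x z^* + z x^* : z ∈ ℂ^d}`. -/
def tangentSpace {d : ℕ} (x : Fin d → ℂ) : Set (Matrix (Fin d) (Fin d) ℂ) :=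
  {Z | ∃ z : Fin d → ℂ, Z = outer x z + outer z x}

/-- The projection `𝒫_T : W ↦ X W + W X - X W X` onto `T`, where `X = x x^*`. -/
def projT {d : ℕ} (x : Fin d → ℂ) (W : Matrix (Fin d) (Fin d) ℂ) :
    Matrix (Fin d) (Fin d) ℂ :=
  outer x x * W + W * outer x x - outer x x * W * outer x x

/-- The projection `𝒫_T^⊥ : W ↦ W - 𝒫_T W` onto the orthocomplement of `T`. -/
def projTPerp {d : ℕ} (x : Fin d → ℂ) (W : Matrix (Fin d) (Fin d) ℂ) :
    Matrix (Fin d) (Fin d) ℂ :=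
  W - projT x W

/-- The truncation rate `γ = 8 + log₂ (b² / ν)`. -/
def truncRate (b ν : ℝ) : ℝ := 8 + Real.logb 2 (b ^ 2 / ν)

/-- The event `U_k = {|tr (F_k Z)| ≤ 2^(3/2) b² γ log d ‖Z‖₂}`, as a condition on the
realization `a` of the modulation pattern. -/
def TruncEvent {d : ℕ} (b ν : ℝ) (Z : Matrix (Fin d) (Fin d) ℂ) (a : Fin d → ℝ) (k : Fin d) :
    Prop :=
  ‖(measMatrix a k * Z).trace‖ ≤
    (2 : ℝ) ^ (3 / 2 : ℝ) * b ^ 2 * truncRate b ν * Real.log d * frobNorm Z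

open scoped Classical in
/-- One summand `ℳ_l^Z` of the truncated measurement operator, for the realization `a` of the
`l`-th modulation pattern: `ℳ_l^Z W = 1/(ν² d L) ∑_k 1_{U_k} F_k tr (F_k W)`. -/
def truncSummand {d : ℕ} (L : ℕ) (b ν : ℝ) (Z : Matrix (Fin d) (Fin d) ℂ) (a : Fin d → ℝ)
    (W : Matrix (Fin d) (Fin d) ℂ) : Matrix (Fin d) (Fin d) ℂ :=
  (1 / (ν ^ 2 * d * L) : ℝ) •
    ∑ k : Fin d, if TruncEvent b ν Z a k then (measMatrix a k * W).trace • measMatrix a k else 0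

/-- The truncated measurement operator `ℛ_Z = ∑_l ℳ_l^Z`, for the realizations `a 0, …, a (L - 1)`
of the `L` modulation patterns. -/
def truncOperator {d L : ℕ} (b ν : ℝ) (Z : Matrix (Fin d) (Fin d) ℂ) (a : Fin L → Fin d → ℝ)
    (W : Matrix (Fin d) (Fin d) ℂ) : Matrix (Fin d) (Fin d) ℂ :=
  ∑ l : Fin L, truncSummand L b ν Z (a l) W

end CodedDiffraction

end

/-! Write `T` for the Frobenius norm of `Z` and `G` for `γ log d`. Without truncation, the operator
applied to `Z` has expectation `Z + tr(Z) Id`: summing over the Fourier index leaves only index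
quadruples with `i - j + m - n ≡ 0 mod d`, and for odd `d` and fourth moment `2ν²` these contribute
exactly the two pairings `i = j, m = n` and `i = n, j = m`
(`IsPattern.integral_weightedMeas_trace`). Since `projTPerp x` kills `Z` and is a contraction, being
compression by the projection `1 - xx^*`, it suffices to bound the deviation of the truncated
operator from `Z + tr(Z) Id` in operator norm.

That deviation is a bias plus a centred fluctuation. The bias is at most `T/16`. For `d < 32` the
truncation never acts; for `d ≥ 32` the bias is controlled by subgaussian tails of the coefficients
`f_k^* D v` together with their eighth moments (`IsPattern.integral_truncation_error_le`). As `t ≥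
1/4`, the bias uses up less than half of `tT`.

The fluctuation is a sum of `L` independent hermitian matrices. Truncation bounds each summand by a
multiple of `b⁴ G T / (ν² L)`. Orthogonality of the Fourier vectors reduces its matrix variance to
sixth-order moments of single coefficients, giving a multiple of `b⁸ T² / (ν⁴ L²)` without a
logarithm (`IsPattern.integral_truncSummand_mulVec_le`). A matrix Bernstein bound then yields the
tail (`measureReal_norm_sum_sub_integral_ge_le`).

The Bernstein bound is of Ahlswede-Winter type: the trace exponential of the sum is peeled one
summand at a time by the Golden-Thompson inequality and `exp A ≤ 1 + A + A²`. Golden-Thompson comes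
from a trace inequality for `2^k`-th powers and the Lie product formula. -/

namespace CodedDiffraction

/-! ### Trace inequalities for powers of a product -/

section GoldenThompson

open Matrix
open scoped Matrix.Norms.L2Operator

variable {n : Type*} [Fintype n]

/-- `tr (Mᴴ M)` is the sum of the squared moduli of the entries of `M`. -/
theorem trace_conjTranspose_mul_self_eq_sum (M : Matrix n n ℂ) :
    (Mᴴ * M).trace = ((∑ i, ∑ j, ‖M j i‖ ^ 2 : ℝ) : ℂ) := by
  simp only [trace, diag_apply, mul_apply, conjTranspose_apply, Complex.ofReal_sum,
    Complex.ofReal_pow]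
  refine Finset.sum_congr rfl fun i _ => Finset.sum_congr rfl fun j _ => ?_
  simpa using Complex.conj_mul' (M j i)

/-- The Cauchy-Schwarz inequality for the trace, in the form of arithmetic and geometric means. -/
theorem norm_trace_mul_le (A B : Matrix n n ℂ) :
    ‖(A * B).trace‖ ≤ ((Aᴴ * A).trace.re + (Bᴴ * B).trace.re) / 2 := by
  rw [trace_conjTranspose_mul_self_eq_sum, trace_conjTranspose_mul_self_eq_sum, Complex.ofReal_re,
    Complex.ofReal_re, Finset.sum_comm, ← Finset.sum_add_distrib, Finset.sum_div]
  simp only [trace, diag_apply, mul_apply]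
  refine (norm_sum_le _ _).trans (Finset.sum_le_sum fun i _ => ?_)
  rw [← Finset.sum_add_distrib, Finset.sum_div]
  refine (norm_sum_le _ _).trans (Finset.sum_le_sum fun j _ => ?_)
  rw [norm_mul]
  nlinarith [sq_nonneg (‖A i j‖ - ‖B j i‖)]

variable [DecidableEq n]

theorem trace_mul_pow_comm (A B : Matrix n n ℂ) (k : ℕ) :
    ((A * B) ^ k).trace = ((B * A) ^ k).trace := by
  cases k with
  | zero => simp
  | succ k =>
    have h : (A * B) ^ (k + 1) = A * ((B * A) ^ k * B) := by
      induction k with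
      | zero => simp
      | succ k ih => rw [pow_succ, ih, pow_succ (B * A) k]; simp only [mul_assoc]
    rw [h, trace_mul_comm, pow_succ, mul_assoc]

/-- The two claims feed each other, hence the joint induction: the second at `k + 1` is the first at
`k` for `M = PQ` followed by the second at `k`; the first at `k + 1` is the first at `k` for `M²`,
then the second at `k` for `P = MᴴM`, `Q = MMᴴ`, and Cauchy-Schwarz. -/
theorem norm_trace_pow_two_pow_le_and (k : ℕ) :
    (∀ M : Matrix n n ℂ, ‖(M ^ 2 ^ (k + 1)).trace‖ ≤ ‖((Mᴴ * M) ^ 2 ^ k).trace‖) ∧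
      ∀ P Q : Matrix n n ℂ, P.IsHermitian → Q.IsHermitian →
        ‖((P * Q) ^ 2 ^ k).trace‖ ≤ ‖(P ^ 2 ^ k * Q ^ 2 ^ k).trace‖ := by
  induction k with
  | zero =>
    refine ⟨fun M => ?_, fun P Q _ _ => by simp⟩
    have h := norm_trace_mul_le M M
    rw [add_self_div_two] at h
    simpa [pow_two] using h.trans (Complex.re_le_norm _)
  | succ k ih =>
    obtain ⟨ha, hb⟩ := ih
    have hb' : ∀ P Q : Matrix n n ℂ, P.IsHermitian → Q.IsHermitian →
        ‖((P * Q) ^ 2 ^ (k + 1)).trace‖ ≤ ‖(P ^ 2 ^ (k + 1) * Q ^ 2 ^ (k + 1)).trace‖ := by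
      intro P Q hP hQ
      refine (ha (P * Q)).trans ?_
      have h1 : (P * Q)ᴴ * (P * Q) = Q * (P ^ 2 * Q) := by
        rw [conjTranspose_mul, hP.eq, hQ.eq, pow_two]; simp only [mul_assoc]
      have h2 : P ^ 2 * Q * Q = P ^ 2 * Q ^ 2 := by rw [pow_two Q, mul_assoc]
      rw [h1, trace_mul_pow_comm, h2]
      refine (hb _ _ (hP.pow 2) (hQ.pow 2)).trans_eq ?_
      rw [← pow_mul, ← pow_mul, ← pow_succ']
    refine ⟨fun M => ?_, hb'⟩
    have e1 : M ^ 2 ^ (k + 1 + 1) = (M ^ 2) ^ 2 ^ (k + 1) := by rw [← pow_mul, ← pow_succ']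
    rw [e1]
    refine (ha _).trans ?_
    have h1 : (M ^ 2)ᴴ * M ^ 2 = Mᴴ * (Mᴴ * M * M) := by
      rw [pow_two, conjTranspose_mul]; simp only [mul_assoc]
    have h2 : Mᴴ * M * M * Mᴴ = (Mᴴ * M) * (M * Mᴴ) := by simp only [mul_assoc]
    rw [h1, trace_mul_pow_comm, h2]
    have hP : (Mᴴ * M).IsHermitian := isHermitian_conjTranspose_mul_self M
    have hQ : (M * Mᴴ).IsHermitian := isHermitian_mul_conjTranspose_self M
    -- After Cauchy-Schwarz the two square terms have equal traces, because `MᴴM` and `MMᴴ` have the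
    -- same power traces, so the mean collapses to one term.
    refine (hb _ _ hP hQ).trans ((norm_trace_mul_le _ _).trans ?_)
    rw [(hP.pow _).eq, (hQ.pow _).eq, ← pow_add, ← pow_add, ← two_mul, ← pow_succ',
      trace_mul_pow_comm M, add_self_div_two]
    exact Complex.re_le_norm _

end GoldenThompson

/-! ### The Lie product formula -/

section LieProduct

variable {𝔸 : Type*} [NormedRing 𝔸]

theorem norm_pow_sub_pow_le [NormOneClass 𝔸] {X Y : 𝔸} {M : ℝ} (hX : ‖X‖ ≤ M) (hY : ‖Y‖ ≤ M)
    (N : ℕ) : ‖X ^ N - Y ^ N‖ ≤ N * M ^ (N - 1) * ‖X - Y‖ := by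
  have hM : 0 ≤ M := (norm_nonneg X).trans hX
  induction N with
  | zero => simp
  | succ N ih =>
    have e : X ^ (N + 1) - Y ^ (N + 1) = X ^ N * (X - Y) + (X ^ N - Y ^ N) * Y := by
      rw [pow_succ, pow_succ]; noncomm_ring
    rw [e]
    have h1 : ‖X ^ N * (X - Y)‖ ≤ M ^ N * ‖X - Y‖ :=
      (norm_mul_le _ _).trans (mul_le_mul_of_nonneg_right
        ((norm_pow_le _ _).trans (pow_le_pow_left₀ (norm_nonneg _) hX _)) (norm_nonneg _))
    have h2 : ‖(X ^ N - Y ^ N) * Y‖ ≤ N * M ^ N * ‖X - Y‖ := by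
      refine (norm_mul_le _ _).trans ((mul_le_mul ih hY (norm_nonneg _) (by positivity)).trans_eq ?_)
      cases N with
      | zero => simp
      | succ N => rw [Nat.add_sub_cancel]; ring
    calc _ ≤ M ^ N * ‖X - Y‖ + N * M ^ N * ‖X - Y‖ := (norm_add_le _ _).trans (add_le_add h1 h2)
      _ = _ := by rw [Nat.add_sub_cancel]; push_cast; ring

theorem norm_exp_le_exp_norm [NormOneClass 𝔸] [NormedAlgebra ℝ 𝔸] [CompleteSpace 𝔸] (x : 𝔸) :
    ‖NormedSpace.exp x‖ ≤ Real.exp ‖x‖ := by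
  have h1 := NormedSpace.exp_series_hasSum_exp' (𝕂 := ℝ) x
  have h2 := NormedSpace.exp_series_hasSum_exp' (𝕂 := ℝ) ‖x‖
  rw [← Real.exp_eq_exp_ℝ] at h2
  refine h1.norm_le_of_bounded h2 fun i => ?_
  rw [norm_smul, smul_eq_mul, Real.norm_of_nonneg (by positivity)]
  gcongr
  exact norm_pow_le _ _

open Filter Topology in
/-- The Lie product formula. -/
theorem tendsto_exp_mul_exp_pow [NormOneClass 𝔸] [NormedAlgebra ℝ 𝔸] [CompleteSpace 𝔸]
    (A B : 𝔸) :
    Tendsto (fun N : ℕ => (NormedSpace.exp ((N : ℝ)⁻¹ • A) * NormedSpace.exp ((N : ℝ)⁻¹ • B)) ^ N)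
      atTop (𝓝 (NormedSpace.exp (A + B))) := by
  set f : ℝ → 𝔸 := fun t => NormedSpace.exp (t • A) * NormedSpace.exp (t • B) -
    NormedSpace.exp (t • (A + B)) with hf
  -- The two exponential curves agree to first order at `0`, so `N ‖f(1/N)‖ → 0`. This beats the
  -- factor `N` lost in comparing `N`-th powers.
  have hd : HasDerivAt f 0 0 := by
    have h := ((hasDerivAt_exp_smul_const (𝕂 := ℝ) A 0).mul
      (hasDerivAt_exp_smul_const (𝕂 := ℝ) B 0)).sub (hasDerivAt_exp_smul_const (𝕂 := ℝ) (A + B) 0)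
    have h' : HasDerivAt f _ 0 := h
    convert! h' using 1
    simp
  have h0 : f 0 = 0 := by simp [hf]
  have hlim : Tendsto (fun N : ℕ => (N : ℝ) * ‖f (N : ℝ)⁻¹‖) atTop (𝓝 0) := by
    have h := hd.tendsto_slope_zero
    have hN : Tendsto (fun N : ℕ => (N : ℝ)⁻¹) atTop (𝓝[≠] 0) :=
      tendsto_nhdsWithin_iff.2 ⟨tendsto_inv_atTop_nhds_zero_nat,
        (eventually_ge_atTop 1).mono fun N hN => by
          have : (N : ℝ) ≠ 0 := by positivity
          simpa using this⟩
    have h2 := (h.comp hN).norm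
    simpa [Function.comp_def, h0, norm_smul] using h2
  rw [tendsto_iff_norm_sub_tendsto_zero]
  have hb : Tendsto (fun N : ℕ => Real.exp (‖A‖ + ‖B‖) * ((N : ℝ) * ‖f (N : ℝ)⁻¹‖)) atTop (𝓝 0) := by
    simpa using hlim.const_mul (Real.exp (‖A‖ + ‖B‖))
  refine squeeze_zero' (Eventually.of_forall fun _ => norm_nonneg _) ?_ hb
  filter_upwards [eventually_ge_atTop 1] with N hN
  have hN0 : (N : ℝ) ≠ 0 := by positivity
  have hi : (0 : ℝ) ≤ (N : ℝ)⁻¹ := by positivity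
  have e : NormedSpace.exp (A + B) = NormedSpace.exp ((N : ℝ)⁻¹ • (A + B)) ^ N := by
    let _ := NormedAlgebra.restrictScalars ℚ ℝ 𝔸
    rw [← NormedSpace.exp_nsmul, ← Nat.cast_smul_eq_nsmul ℝ, smul_smul, mul_inv_cancel₀ hN0,
      one_smul]
  rw [e]
  -- This common bound for both factors satisfies `M ^ N = exp (‖A‖ + ‖B‖)`, so the powers stay
  -- bounded as `N` grows.
  set M : ℝ := Real.exp ((N : ℝ)⁻¹ * (‖A‖ + ‖B‖)) with hM
  have hx : ‖NormedSpace.exp ((N : ℝ)⁻¹ • A) * NormedSpace.exp ((N : ℝ)⁻¹ • B)‖ ≤ M := by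
    rw [hM, mul_add, Real.exp_add]
    refine (norm_mul_le _ _).trans (mul_le_mul ?_ ?_ (norm_nonneg _) (Real.exp_pos _).le)
    · simpa [norm_smul] using norm_exp_le_exp_norm ((N : ℝ)⁻¹ • A)
    · simpa [norm_smul] using norm_exp_le_exp_norm ((N : ℝ)⁻¹ • B)
  have hy : ‖NormedSpace.exp ((N : ℝ)⁻¹ • (A + B))‖ ≤ M := by
    refine (norm_exp_le_exp_norm _).trans (Real.exp_le_exp.2 ?_)
    rw [norm_smul, Real.norm_of_nonneg hi]
    exact mul_le_mul_of_nonneg_left (norm_add_le _ _) hi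
  refine (norm_pow_sub_pow_le hx hy N).trans ?_
  have hMp : M ^ (N - 1) ≤ Real.exp (‖A‖ + ‖B‖) := by
    have h1 : 1 ≤ M := Real.one_le_exp (by positivity)
    refine (pow_le_pow_right₀ h1 (Nat.sub_le N 1)).trans_eq ?_
    rw [hM, ← Real.exp_nat_mul, ← mul_assoc, mul_inv_cancel₀ hN0, one_mul]
  calc _ ≤ N * Real.exp (‖A‖ + ‖B‖) * ‖f (N : ℝ)⁻¹‖ := by
        gcongr
    _ = _ := by ring

end LieProduct

/-! ### The Golden-Thompson inequality -/

section GoldenThompson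

open Matrix
open scoped Matrix.Norms.L2Operator

variable {n : Type*} [Fintype n] [DecidableEq n]

open Filter Topology in
/-- The Golden-Thompson inequality. -/
theorem norm_trace_exp_add_le [Nonempty n] {A B : Matrix n n ℂ} (hA : A.IsHermitian)
    (hB : B.IsHermitian) :
    ‖(NormedSpace.exp (A + B)).trace‖ ≤ ‖(NormedSpace.exp A * NormedSpace.exp B).trace‖ := by
  have h1 := (tendsto_exp_mul_exp_pow A B).comp
    (tendsto_pow_atTop_atTop_of_one_lt (r := 2) one_lt_two)
  have hc : Continuous fun M : Matrix n n ℂ => ‖M.trace‖ := by fun_prop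
  -- Along `N = 2^k` every term of the Lie product is already bounded by the right-hand side, which
  -- does not depend on `k`.
  refine le_of_tendsto ((hc.tendsto _).comp h1) (Eventually.of_forall fun k => ?_)
  simp only [Function.comp_apply]
  have hh : ∀ C : Matrix n n ℂ, C.IsHermitian →
      (NormedSpace.exp (((2 ^ k : ℕ) : ℝ)⁻¹ • C)).IsHermitian := fun C hC =>
    Matrix.IsHermitian.exp (by
      unfold Matrix.IsHermitian; rw [conjTranspose_smul, hC.eq]; simp)
  have hp : ∀ C : Matrix n n ℂ, NormedSpace.exp (((2 ^ k : ℕ) : ℝ)⁻¹ • C) ^ 2 ^ k =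
      NormedSpace.exp C := fun C => by
    rw [← Matrix.exp_nsmul, ← Nat.cast_smul_eq_nsmul ℝ, smul_smul, mul_inv_cancel₀ (by positivity),
      one_smul]
  refine ((norm_trace_pow_two_pow_le_and k).2 _ _ (hh A hA) (hh B hB)).trans_eq ?_
  rw [hp, hp]

end GoldenThompson

end CodedDiffraction

namespace CodedDiffraction

/-! ### Matrix Laplace transform and Bernstein bound for centred summands -/

section MatrixBernstein

open Matrix
open scoped Matrix.Norms.L2Operator MatrixOrder ComplexOrder

variable {n : Type*} [Fintype n] [DecidableEq n]

/-- The scalar inequality `exp x ≤ 1 + x + x²` on `[-1, 1]`, transferred by the functional calculus.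
-/
theorem posSemidef_sub_exp [Nonempty n] {A : Matrix n n ℂ} (hA : A.IsHermitian) (h1 : ‖A‖ ≤ 1) :
    (1 + A + A * A - NormedSpace.exp A).PosSemidef := by
  have hs : IsSelfAdjoint A := hA
  rw [← Matrix.le_iff]
  have e1 : NormedSpace.exp A = cfc Real.exp A := (CFC.real_exp_eq_normedSpace_exp hs).symm
  have e2 : 1 + A + A * A = cfc (fun x : ℝ => 1 + x + x * x) A := by
    rw [cfc_add A (fun x : ℝ => 1 + x) (fun x : ℝ => x * x), cfc_add A (fun _ : ℝ => 1) (fun x : ℝ => x),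
      cfc_mul (fun x : ℝ => x) (fun x : ℝ => x) A, cfc_const_one ℝ A, cfc_id' ℝ A]
  rw [e1, e2]
  refine cfc_mono fun x hx => ?_
  have hn : |x| ≤ 1 := (spectrum.norm_le_norm_of_mem hx).trans h1
  have := (abs_le.1 (Real.abs_exp_sub_one_sub_id_le hn)).2
  nlinarith

theorem posSemidef_exp {A : Matrix n n ℂ} (hA : A.IsHermitian) :
    (NormedSpace.exp A).PosSemidef := by
  have h2 : NormedSpace.exp A =
      (NormedSpace.exp ((1 / 2 : ℝ) • A))ᴴ * NormedSpace.exp ((1 / 2 : ℝ) • A) := by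
    rw [(Matrix.IsHermitian.exp (hA.smul (k := (1 / 2 : ℝ)) (by simp [IsSelfAdjoint]))).eq,
      ← Matrix.exp_add_of_commute _ _ (Commute.refl _), ← add_smul]
    norm_num
  rw [h2]
  exact posSemidef_conjTranspose_mul_self _

/-- The exponential trace dominates the exponential of the norm, up to a sign. -/
theorem exp_norm_le_trace_add [Nonempty n] {A : Matrix n n ℂ} (hA : A.IsHermitian) :
    Real.exp ‖A‖ ≤ (NormedSpace.exp A).trace.re + (NormedSpace.exp (-A)).trace.re := by
  have hs : IsSelfAdjoint A := hA
  have htr : ∀ f : ℝ → ℝ, (cfc f A).trace.re = ∑ i, f (hA.eigenvalues i) := fun f => by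
    rw [hA.cfc_eq, Matrix.IsHermitian.cfc, Unitary.conjStarAlgAut_apply, trace_mul_comm,
      ← mul_assoc, Unitary.coe_star_mul_self, one_mul, trace_diagonal]
    simp
  have e1 : NormedSpace.exp A = cfc Real.exp A := (CFC.real_exp_eq_normedSpace_exp hs).symm
  have e2 : NormedSpace.exp (-A) = cfc (fun x => Real.exp (-x)) A := by
    rw [cfc_comp_neg Real.exp A, CFC.real_exp_eq_normedSpace_exp hs.neg]
  obtain ⟨i, hi⟩ := Finite.exists_max fun i => |hA.eigenvalues i|
  have hn : ‖A‖ ≤ |hA.eigenvalues i| := by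
    have h1 := congrArg norm hA.conjStarAlgAut_star_eigenvectorUnitary
    rw [Unitary.conjStarAlgAut_apply, ← Unitary.coe_star, CStarRing.norm_mul_coe_unitary,
      CStarRing.norm_coe_unitary_mul, l2_opNorm_diagonal] at h1
    rw [h1]
    refine (pi_norm_le_iff_of_nonneg (abs_nonneg _)).2 fun j => ?_
    simpa using hi j
  rw [e1, e2, htr, htr, ← Finset.sum_add_distrib]
  refine le_trans ?_ (Finset.single_le_sum (f := fun i => Real.exp (hA.eigenvalues i) +
    Real.exp (-hA.eigenvalues i)) (fun j _ => by positivity) (Finset.mem_univ i))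
  refine (Real.exp_le_exp.2 hn).trans ?_
  rcases abs_cases (hA.eigenvalues i) with h | h <;> rw [h.1]
  · exact le_add_of_nonneg_right (Real.exp_pos _).le
  · exact le_add_of_nonneg_left (Real.exp_pos _).le

/-- With `S = MᴴM`, the difference of the traces is the trace of `M (C - B) Mᴴ`. -/
theorem re_trace_mul_mono {S B C : Matrix n n ℂ} (hS : S.PosSemidef) (h : (C - B).PosSemidef) :
    (S * B).trace.re ≤ (S * C).trace.re := by
  obtain ⟨M, hM⟩ := CStarAlgebra.nonneg_iff_eq_star_mul_self.1 hS.nonneg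
  have h2 := (h.mul_mul_conjTranspose_same M).trace_nonneg
  have e : (M * (C - B) * Mᴴ).trace = (S * C).trace - (S * B).trace := by
    rw [trace_mul_comm, ← mul_assoc, hM, star_eq_conjTranspose, mul_sub, trace_sub]
  rw [e, Complex.nonneg_iff] at h2
  simpa using h2.1

theorem norm_trace_mul_of_posSemidef {S B : Matrix n n ℂ} (hS : S.PosSemidef)
    (hB : B.PosSemidef) : ‖(S * B).trace‖ = (S * B).trace.re := by
  obtain ⟨M, hM⟩ := CStarAlgebra.nonneg_iff_eq_star_mul_self.1 hS.nonneg
  have h2 := (hB.mul_mul_conjTranspose_same M).trace_nonneg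
  rw [trace_mul_comm, ← mul_assoc, ← star_eq_conjTranspose, ← hM] at h2
  rw [← Complex.ofReal_inj, ← Complex.eq_coe_norm_of_nonneg h2]
  exact Complex.ext rfl (Complex.nonneg_iff.1 h2).2.symm

noncomputable instance instMeasurableSpaceMatrix : MeasurableSpace (Matrix n n ℂ) := MeasurableSpace.pi

instance instBorelSpaceMatrix : BorelSpace (Matrix n n ℂ) :=
  inferInstanceAs (BorelSpace (n → n → ℂ))

instance instSecondCountableTopologyMatrix : SecondCountableTopology (Matrix n n ℂ) :=
  inferInstanceAs (SecondCountableTopology (n → n → ℂ))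

variable {Ω : Type*} [MeasurableSpace Ω] {P : Measure Ω}

theorem integral_matrix_apply {X : Ω → Matrix n n ℂ} (hX : Integrable X P) (i j : n) :
    (∫ ω, X ω ∂P) i j = ∫ ω, X ω i j ∂P :=
  ((LinearMap.toContinuousLinearMap (Matrix.entryLinearMap ℂ ℂ i j)).integral_comp_comm hX).symm

theorem integrable_matrix_apply {X : Ω → Matrix n n ℂ} (hX : Integrable X P) (i j : n) :
    Integrable (fun ω => X ω i j) P :=
  (LinearMap.toContinuousLinearMap (Matrix.entryLinearMap ℂ ℂ i j)).integrable_comp hX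

theorem integral_matrix_mul_of_indepFun {X Y : Ω → Matrix n n ℂ} (hX : Integrable X P)
    (hY : Integrable Y P) (hXY : Integrable (fun ω => X ω * Y ω) P) (h : IndepFun X Y P) :
    ∫ ω, X ω * Y ω ∂P = (∫ ω, X ω ∂P) * ∫ ω, Y ω ∂P := by
  have hm : ∀ i j : n, Measurable fun M : Matrix n n ℂ => M i j := fun i j =>
    (measurable_pi_apply j).comp (measurable_pi_apply i)
  have hij : ∀ i j k, IndepFun (fun ω => X ω i j) (fun ω => Y ω j k) P := fun i j k =>
    h.comp (hm i j) (hm j k)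
  ext i k
  simp only [integral_matrix_apply hXY, mul_apply, integral_matrix_apply hX,
    integral_matrix_apply hY]
  have hint : ∀ j, Integrable (fun ω => X ω i j * Y ω j k) P := fun j =>
    (hij i j k).integrable_mul (integrable_matrix_apply hX i j) (integrable_matrix_apply hY j k)
  rw [integral_finsetSum _ fun j _ => hint j]
  exact Finset.sum_congr rfl fun j _ => (hij i j k).integral_fun_mul_eq_mul_integral
    (integrable_matrix_apply hX i j).aestronglyMeasurable
    (integrable_matrix_apply hY j k).aestronglyMeasurable

theorem integral_re_trace {X : Ω → Matrix n n ℂ} (hX : Integrable X P) :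
    ∫ ω, (X ω).trace.re ∂P = (∫ ω, X ω ∂P).trace.re :=
  ((Complex.reCLM.comp ((LinearMap.toContinuousLinearMap (Matrix.traceLinearMap n ℂ ℂ)).restrictScalars
    ℝ)).integral_comp_comm hX)

theorem integrable_re_trace {X : Ω → Matrix n n ℂ} (hX : Integrable X P) :
    Integrable (fun ω => (X ω).trace.re) P :=
  ((Complex.reCLM.comp ((LinearMap.toContinuousLinearMap (Matrix.traceLinearMap n ℂ ℂ)).restrictScalars
    ℝ)).integrable_comp hX)

variable [IsProbabilityMeasure P] [Nonempty n]

/-- Each peeled summand costs a factor `1 + v`: Golden-Thompson separates it, `posSemidef_sub_exp`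
makes its exponential quadratic, independence kills the linear term because the mean is zero, and
the quadratic term is bounded through `hvar`. The empty sum contributes the dimension. -/
theorem integral_re_trace_exp_sum_le {ι : Type*} {A : ι → Ω → Matrix n n ℂ} {v : ℝ} (hv : 0 ≤ v)
    (hm : ∀ l, Measurable (A l)) (hA : iIndepFun A P) (hh : ∀ l ω, (A l ω).IsHermitian)
    (hb : ∀ l ω, ‖A l ω‖ ≤ 1) (h0 : ∀ l, ∫ ω, A l ω ∂P = 0)
    (hvar : ∀ l, ((v : ℂ) • (1 : Matrix n n ℂ) - ∫ ω, A l ω * A l ω ∂P).PosSemidef)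
    (s : Finset ι) :
    ∫ ω, (NormedSpace.exp (∑ l ∈ s, A l ω)).trace.re ∂P ≤ Fintype.card n * (1 + v) ^ s.card := by
  classical
  have hexp : Measurable (NormedSpace.exp : Matrix n n ℂ → Matrix n n ℂ) :=
    Continuous.measurable (let _ := NormedAlgebra.restrictScalars ℚ ℂ (Matrix n n ℂ);
      NormedSpace.exp_continuous)
  have hmS : ∀ s : Finset ι, Measurable fun ω => ∑ l ∈ s, A l ω := fun s =>
    Finset.measurable_fun_sum s fun l _ => hm l
  have hiE : ∀ s : Finset ι, Integrable (fun ω => NormedSpace.exp (∑ l ∈ s, A l ω)) P := fun s =>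
    Integrable.of_bound (hexp.comp (hmS s)).aestronglyMeasurable (Real.exp s.card)
      (Filter.Eventually.of_forall fun ω => (norm_exp_le_exp_norm _).trans (Real.exp_le_exp.2
        ((norm_sum_le _ _).trans ((Finset.sum_le_sum fun l _ => hb l ω).trans (by simp)))))
  have hhS : ∀ (s : Finset ι) ω, (∑ l ∈ s, A l ω).IsHermitian := fun s ω =>
    isSelfAdjoint_sum s fun l _ => hh l ω
  induction s using Finset.induction_on with
  | empty => simp
  | insert j s hj ih =>
    have hind : IndepFun (∑ l ∈ s, A l) (A j) P := hA.indepFun_finsetSum_of_notMem hm hj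
    have hE : IndepFun (fun ω => NormedSpace.exp (∑ l ∈ s, A l ω)) (A j) P := by
      have := hind.comp hexp measurable_id
      simpa [Function.comp_def] using this
    have hE2 : IndepFun (fun ω => NormedSpace.exp (∑ l ∈ s, A l ω)) (fun ω => A j ω * A j ω) P :=
      hE.comp measurable_id (φ := id) (ψ := fun M => M * M) (by fun_prop)
    have hiA : Integrable (A j) P := Integrable.of_bound (hm j).aestronglyMeasurable 1
      (Filter.Eventually.of_forall fun ω => hb j ω)
    have hiA2 : Integrable (fun ω => A j ω * A j ω) P :=
      Integrable.of_bound ((hm j).mul (hm j)).aestronglyMeasurable 1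
      (Filter.Eventually.of_forall fun ω => (norm_mul_le _ _).trans
        (mul_le_one₀ (hb j ω) (norm_nonneg _) (hb j ω)))
    set E : Ω → Matrix n n ℂ := fun ω => NormedSpace.exp (∑ l ∈ s, A l ω) with hEdef
    have hEpos : ∀ ω, (E ω).PosSemidef := fun ω => posSemidef_exp (hhS s ω)
    have hmul : ∀ {B : Ω → Matrix n n ℂ}, Measurable B → (∀ ω, ‖B ω‖ ≤ 1) →
        Integrable (fun ω => E ω * B ω) P := fun {B} hB hB1 =>
      Integrable.mono (hiE s) (((hexp.comp (hmS s)).mul hB).aestronglyMeasurable)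
        (Filter.Eventually.of_forall fun ω => (norm_mul_le _ _).trans
          (mul_le_of_le_one_right (norm_nonneg _) (hB1 ω)))
    have hi1 : Integrable (fun ω => E ω * A j ω) P := hmul (hm j) (hb j)
    have hi2 : Integrable (fun ω => E ω * (A j ω * A j ω)) P := hmul ((hm j).mul (hm j))
      fun ω => (norm_mul_le _ _).trans (mul_le_one₀ (hb j ω) (norm_nonneg _) (hb j ω))
    have hpt : ∀ ω, (NormedSpace.exp (∑ l ∈ insert j s, A l ω)).trace.re ≤
        (E ω).trace.re + (E ω * A j ω).trace.re + (E ω * (A j ω * A j ω)).trace.re := by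
      intro ω
      rw [Finset.sum_insert hj, add_comm]
      refine (Complex.re_le_norm _).trans ((norm_trace_exp_add_le (hhS s ω) (hh j ω)).trans ?_)
      rw [norm_trace_mul_of_posSemidef (hEpos ω) (posSemidef_exp (hh j ω))]
      refine (re_trace_mul_mono (hEpos ω) (posSemidef_sub_exp (hh j ω) (hb j ω))).trans_eq ?_
      simp [mul_add]
    have h1 : ∫ ω, (E ω * A j ω).trace.re ∂P = 0 := by
      rw [integral_re_trace hi1, integral_matrix_mul_of_indepFun (hiE s) hiA hi1 hE, h0]
      simp
    have h2 : ∫ ω, (E ω * (A j ω * A j ω)).trace.re ∂P ≤ v * ∫ ω, (E ω).trace.re ∂P := by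
      have hic : ∀ G : Matrix n n ℂ, Integrable (fun ω => E ω * G) P := fun G =>
        (ContinuousLinearMap.mul ℂ (Matrix n n ℂ)).flip G |>.integrable_comp (hiE s)
      have e : (∫ ω, E ω ∂P) * (∫ ω, A j ω * A j ω ∂P) = ∫ ω, E ω * ∫ ω, A j ω * A j ω ∂P ∂P :=
        ((ContinuousLinearMap.mul ℂ (Matrix n n ℂ)).flip _ |>.integral_comp_comm (hiE s)).symm
      rw [integral_re_trace hi2, integral_matrix_mul_of_indepFun (hiE s) hiA2 hi2 hE2, e,
        ← integral_re_trace (hic _), ← integral_const_mul]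
      refine integral_mono (integrable_re_trace (hic _)) ((integrable_re_trace (hiE s)).const_mul v)
        fun ω => (re_trace_mul_mono (hEpos ω) (hvar j)).trans_eq ?_
      simp
    calc _ ≤ ∫ ω, ((E ω).trace.re + (E ω * A j ω).trace.re + (E ω * (A j ω * A j ω)).trace.re) ∂P :=
          integral_mono (integrable_re_trace (hiE _)) (((integrable_re_trace (hiE s)).add
            (integrable_re_trace hi1)).add (integrable_re_trace hi2)) hpt
      _ = ∫ ω, (E ω).trace.re ∂P + ∫ ω, (E ω * (A j ω * A j ω)).trace.re ∂P := by
          have i0 : Integrable (fun ω => (E ω).trace.re) P := integrable_re_trace (hiE s)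
          have i01 : Integrable (fun ω => (E ω).trace.re + (E ω * A j ω).trace.re) P :=
            i0.add (integrable_re_trace hi1)
          rw [integral_add i01 (integrable_re_trace hi2),
            integral_add i0 (integrable_re_trace hi1), h1, add_zero]
      _ ≤ (1 + v) * ∫ ω, (E ω).trace.re ∂P := by linarith
      _ ≤ (1 + v) * (Fintype.card n * (1 + v) ^ s.card) := by gcongr
      _ = _ := by rw [Finset.card_insert_of_notMem hj]; ring

/-- A matrix Bernstein inequality, before the optimization of its scale. -/
theorem measureReal_norm_sum_ge_le {ι : Type*} [Fintype ι] {A : ι → Ω → Matrix n n ℂ} {v : ℝ}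
    (hv : 0 ≤ v) (hm : ∀ l, Measurable (A l)) (hA : iIndepFun A P)
    (hh : ∀ l ω, (A l ω).IsHermitian) (hb : ∀ l ω, ‖A l ω‖ ≤ 1) (h0 : ∀ l, ∫ ω, A l ω ∂P = 0)
    (hvar : ∀ l, ((v : ℂ) • (1 : Matrix n n ℂ) - ∫ ω, A l ω * A l ω ∂P).PosSemidef) (r : ℝ) :
    P.real {ω | r ≤ ‖∑ l, A l ω‖} ≤
      2 * Fintype.card n * Real.exp (Fintype.card ι * v - r) := by
  have hexp : Measurable (NormedSpace.exp : Matrix n n ℂ → Matrix n n ℂ) :=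
    Continuous.measurable (let _ := NormedAlgebra.restrictScalars ℚ ℂ (Matrix n n ℂ);
      NormedSpace.exp_continuous)
  have key : ∀ B : ι → Ω → Matrix n n ℂ, (∀ l, Measurable (B l)) → (∀ l ω, ‖B l ω‖ ≤ 1) →
      Integrable (fun ω => (NormedSpace.exp (∑ l, B l ω)).trace.re) P := fun B hB hB1 =>
    integrable_re_trace (Integrable.of_bound
      (hexp.comp (Finset.measurable_fun_sum _ fun l _ => hB l)).aestronglyMeasurable
      (Real.exp (Fintype.card ι))
      (Filter.Eventually.of_forall fun ω => (norm_exp_le_exp_norm _).trans (Real.exp_le_exp.2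
        ((norm_sum_le _ _).trans ((Finset.sum_le_sum fun l _ => hB1 l ω).trans (by simp))))))
  have hb' : ∀ l ω, ‖-A l ω‖ ≤ 1 := fun l ω => by rw [norm_neg]; exact hb l ω
  have i1 := key A hm hb
  have i2 := key (fun l ω => -A l ω) (fun l => (hm l).neg) hb'
  have b1 := integral_re_trace_exp_sum_le hv hm hA hh hb h0 hvar Finset.univ
  -- The norm sees both ends of the spectrum, so the Laplace bound is also needed for `-A`; this is
  -- the source of the factor 2 before the dimension.
  have b2 := integral_re_trace_exp_sum_le (A := fun l ω => -A l ω) hv (fun l => (hm l).neg)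
    (hA.comp (fun _ M => -M) fun _ => measurable_neg) (fun l ω => (hh l ω).neg) hb'
    (fun l => by rw [integral_neg, h0, neg_zero]) (fun l => by simpa using hvar l) Finset.univ
  set f : Ω → ℝ := fun ω => (NormedSpace.exp (∑ l, A l ω)).trace.re +
    (NormedSpace.exp (∑ l, -A l ω)).trace.re with hf
  have hhS : ∀ ω, (∑ l, A l ω).IsHermitian := fun ω => isSelfAdjoint_sum _ fun l _ => hh l ω
  have hfexp : ∀ ω, Real.exp ‖∑ l, A l ω‖ ≤ f ω := fun ω => by
    simpa [hf] using exp_norm_le_trace_add (hhS ω)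
  have hsub : {ω | r ≤ ‖∑ l, A l ω‖} ⊆ {ω | Real.exp r ≤ f ω} := fun ω hω =>
    (Real.exp_le_exp.2 hω).trans (hfexp ω)
  have hmk := mul_meas_ge_le_integral_of_nonneg (μ := P) (f := f)
    (Filter.Eventually.of_forall fun ω => (Real.exp_pos _).le.trans (hfexp ω)) (i1.add i2)
    (Real.exp r)
  have hint : ∫ ω, f ω ∂P ≤ 2 * Fintype.card n * Real.exp (Fintype.card ι * v) := by
    have hp : (1 + v) ^ (Finset.univ : Finset ι).card ≤ Real.exp (Fintype.card ι * v) := by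
      rw [Real.exp_nat_mul, Finset.card_univ]
      gcongr
      linarith [Real.add_one_le_exp v]
    have hN : (0 : ℝ) ≤ Fintype.card n := by positivity
    rw [hf, integral_add i1 i2]
    nlinarith [mul_le_mul_of_nonneg_left hp hN]
  have h3 := measureReal_mono (μ := P) hsub
  rw [Real.exp_sub, ← mul_div_assoc, le_div_iff₀ (Real.exp_pos r), mul_comm]
  exact (mul_le_mul_of_nonneg_left h3 (Real.exp_pos r).le).trans (hmk.trans hint)

end MatrixBernstein

end CodedDiffraction

namespace CodedDiffraction

/-! ### Operator norm criteria and Bernstein for summands that are not centred -/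

section CenteredBernstein

open Matrix
open scoped Matrix.Norms.L2Operator MatrixOrder ComplexOrder

variable {n : Type*} [Fintype n]

theorem star_dotProduct_self_eq_sum (u : n → ℂ) :
    star u ⬝ᵥ u = ((∑ i, ‖u i‖ ^ 2 : ℝ) : ℂ) := by
  simp only [dotProduct, Pi.star_apply, Complex.ofReal_sum, Complex.ofReal_pow]
  exact Finset.sum_congr rfl fun i _ => by simpa using Complex.conj_mul' (u i)

variable [DecidableEq n]

theorem opNorm_le_of_sum_le {M : Matrix n n ℂ} {K : ℝ} (hK : 0 ≤ K)
    (h : ∀ u : n → ℂ, ∑ i, ‖(M *ᵥ u) i‖ ^ 2 ≤ K ^ 2 * ∑ i, ‖u i‖ ^ 2) : ‖M‖ ≤ K := by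
  rw [cstar_norm_def]
  refine ContinuousLinearMap.opNorm_le_bound _ hK fun u => ?_
  refine (sq_le_sq₀ (norm_nonneg _) (by positivity)).1 ?_
  rw [mul_pow, EuclideanSpace.norm_sq_eq, EuclideanSpace.norm_sq_eq]
  exact h u.ofLp

theorem opNorm_le_of_bilinear_le {M : Matrix n n ℂ} {K : ℝ} (hK : 0 ≤ K)
    (h : ∀ u v : n → ℂ, ∑ i, ‖u i‖ ^ 2 = 1 → ∑ i, ‖v i‖ ^ 2 = 1 → ‖star u ⬝ᵥ M *ᵥ v‖ ≤ K) :
    ‖M‖ ≤ K := by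
  have hnorm : ∀ u : n → ℂ, u ≠ 0 → 0 < ∑ i, ‖u i‖ ^ 2 := fun u hu => by
    obtain ⟨i, hi⟩ := Function.ne_iff.1 hu
    exact Finset.sum_pos' (fun j _ => by positivity)
      ⟨i, Finset.mem_univ i, pow_pos (norm_pos_iff.2 hi) 2⟩
  have hscale : ∀ u : n → ℂ, u ≠ 0 →
      ∑ i, ‖(((√(∑ i, ‖u i‖ ^ 2))⁻¹ : ℂ) • u) i‖ ^ 2 = 1 := fun u hu => by
    have h1 := hnorm u hu
    simp only [Pi.smul_apply, smul_eq_mul, norm_mul, mul_pow, ← Finset.mul_sum]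
    rw [norm_inv, Complex.norm_real, Real.norm_of_nonneg (Real.sqrt_nonneg _), inv_pow,
      Real.sq_sqrt h1.le, inv_mul_cancel₀ h1.ne']
  refine opNorm_le_of_sum_le hK fun u => ?_
  by_cases hM : M *ᵥ u = 0
  · exact le_of_eq_of_le (b := 0) (by simp [hM]) (by positivity)
  have hu : u ≠ 0 := fun h0 => hM (by rw [h0, mulVec_zero])
  -- Tested on the normalizations of `M u` and `u`, the form equals `‖M u‖ / ‖u‖`.
  have h1 := h _ _ (hscale _ hM) (hscale u hu)
  set s := √(∑ i, ‖u i‖ ^ 2) with hs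
  set r := √(∑ i, ‖(M *ᵥ u) i‖ ^ 2) with hr
  have hs0 : 0 < s := Real.sqrt_pos.2 (hnorm u hu)
  have hr0 : 0 < r := Real.sqrt_pos.2 (hnorm _ hM)
  have hs2 : ∑ i, ‖u i‖ ^ 2 = s ^ 2 := (Real.sq_sqrt (hnorm u hu).le).symm
  have hr2 : ∑ i, ‖(M *ᵥ u) i‖ ^ 2 = r ^ 2 := (Real.sq_sqrt (hnorm _ hM).le).symm
  rw [mulVec_smul, dotProduct_smul, star_smul, smul_dotProduct, star_dotProduct_self_eq_sum, hr2,
    smul_eq_mul, smul_eq_mul, norm_mul, norm_mul, norm_star, norm_inv, norm_inv, Complex.norm_real,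
    Complex.norm_real, Complex.norm_real, Real.norm_of_nonneg hs0.le, Real.norm_of_nonneg hr0.le,
    Real.norm_of_nonneg (by positivity : (0 : ℝ) ≤ r ^ 2)] at h1
  have h2 : s⁻¹ * (r⁻¹ * r ^ 2) = r / s := by field_simp
  rw [h2, div_le_iff₀ hs0] at h1
  rw [hs2, hr2, ← mul_pow]
  exact pow_le_pow_left₀ hr0.le h1 2

variable {Ω : Type*} [MeasurableSpace Ω] {P : Measure Ω}

theorem integral_dotProduct_mulVec {X : Ω → Matrix n n ℂ} (hX : Integrable X P) (u v : n → ℂ) :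
    ∫ ω, u ⬝ᵥ X ω *ᵥ v ∂P = u ⬝ᵥ (∫ ω, X ω ∂P) *ᵥ v := by
  let φ : Matrix n n ℂ →ₗ[ℂ] ℂ :=
    { toFun := fun M => u ⬝ᵥ M *ᵥ v
      map_add' := fun M N => by rw [add_mulVec, dotProduct_add]
      map_smul' := fun c M => by rw [smul_mulVec, dotProduct_smul]; rfl }
  exact (LinearMap.toContinuousLinearMap φ).integral_comp_comm hX

theorem integral_isHermitian {X : Ω → Matrix n n ℂ} (hX : ∀ ω, (X ω).IsHermitian) :
    (∫ ω, X ω ∂P).IsHermitian := by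
  have h := (starL' ℝ (A := Matrix n n ℂ)).integral_comp_comm (μ := P) X
  have e : ∀ ω, starL' ℝ (X ω) = X ω := fun ω => hX ω
  simp only [e] at h
  exact h.symm

variable [IsProbabilityMeasure P] [Nonempty n]

/-- The previous bound for the centred summands scaled by `θ`. Centring at most doubles the norm,
whence `2 * θ * B ≤ 1`. The variance is asked for as a quadratic form because `⟨u, E[Y²] u⟩ = E ‖Y
u‖²` for hermitian `Y`. -/
theorem measureReal_norm_sum_sub_integral_ge_le {ι : Type*} [Fintype ι]
    {Y : ι → Ω → Matrix n n ℂ} {B V θ : ℝ} (hV : 0 ≤ V) (hθ : 0 ≤ θ)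
    (hm : ∀ l, Measurable (Y l)) (hY : iIndepFun Y P)
    (hh : ∀ l ω, (Y l ω).IsHermitian) (hb : ∀ l ω, ‖Y l ω‖ ≤ B)
    (hvar : ∀ l (u : n → ℂ), ∫ ω, ∑ i, ‖(Y l ω *ᵥ u) i‖ ^ 2 ∂P ≤ V * ∑ i, ‖u i‖ ^ 2)
    (hB : 2 * θ * B ≤ 1) (r : ℝ) :
    P.real {ω | r ≤ ‖∑ l, (Y l ω - ∫ ω, Y l ω ∂P)‖} ≤
      2 * Fintype.card n * Real.exp (Fintype.card ι * (θ ^ 2 * V) - θ * r) := by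
  have hi : ∀ l, Integrable (Y l) P := fun l => Integrable.of_bound (hm l).aestronglyMeasurable B
    (Filter.Eventually.of_forall fun ω => hb l ω)
  have hi2 : ∀ l, Integrable (fun ω => Y l ω * Y l ω) P := fun l =>
    Integrable.of_bound ((hm l).mul (hm l)).aestronglyMeasurable (B * B)
    (Filter.Eventually.of_forall fun ω => (norm_mul_le _ _).trans
      (mul_le_mul (hb l ω) (hb l ω) (norm_nonneg _) ((norm_nonneg _).trans (hb l ω))))
  have hEh : ∀ l, (∫ ω, Y l ω ∂P).IsHermitian := fun l => integral_isHermitian (hh l)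
  have hEn : ∀ l, ‖∫ ω, Y l ω ∂P‖ ≤ B := fun l => by
    simpa using norm_integral_le_of_norm_le_const (μ := P) (Filter.Eventually.of_forall (hb l))
  have hsm : ∀ M : Matrix n n ℂ, M.IsHermitian → (θ • M).IsHermitian := fun M hM => by
    unfold Matrix.IsHermitian; rw [conjTranspose_smul, hM.eq]; simp
  have hsq : ∀ l, ∫ ω, (Y l ω - ∫ ω, Y l ω ∂P) * (Y l ω - ∫ ω, Y l ω ∂P) ∂P =
      (∫ ω, Y l ω * Y l ω ∂P) - (∫ ω, Y l ω ∂P) * ∫ ω, Y l ω ∂P := by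
    intro l
    set E := ∫ ω, Y l ω ∂P with hE
    have e1 : ∫ ω, Y l ω * E ∂P = E * E :=
      (ContinuousLinearMap.mul ℂ (Matrix n n ℂ)).flip E |>.integral_comp_comm (hi l)
    have e2 : ∫ ω, E * Y l ω ∂P = E * E :=
      (ContinuousLinearMap.mul ℂ (Matrix n n ℂ)) E |>.integral_comp_comm (hi l)
    have i1 : Integrable (fun ω => Y l ω * E) P :=
      (ContinuousLinearMap.mul ℂ (Matrix n n ℂ)).flip E |>.integrable_comp (hi l)
    have i2 : Integrable (fun ω => E * Y l ω) P :=
      (ContinuousLinearMap.mul ℂ (Matrix n n ℂ)) E |>.integrable_comp (hi l)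
    have e : ∀ ω, (Y l ω - E) * (Y l ω - E) = (Y l ω * Y l ω - Y l ω * E) - (E * Y l ω - E * E) :=
      fun ω => by noncomm_ring
    have i3 : Integrable (fun ω => Y l ω * Y l ω - Y l ω * E) P := (hi2 l).sub i1
    have i4 : Integrable (fun ω => E * Y l ω - E * E) P := i2.sub (integrable_const _)
    simp_rw [e]
    rw [integral_sub i3 i4, integral_sub (hi2 l) i1, integral_sub i2 (integrable_const _), e1, e2]
    simp
  have key := measureReal_norm_sum_ge_le (P := P) (v := θ ^ 2 * V)
    (A := fun l ω => θ • (Y l ω - ∫ ω, Y l ω ∂P)) (by positivity)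
    (fun l => ((hm l).sub_const _).const_smul θ)
    (hY.comp (fun l M => θ • (M - ∫ ω, Y l ω ∂P)) fun l => (measurable_id.sub_const _).const_smul θ)
    (fun l ω => hsm _ ((hh l ω).sub (hEh l)))
    (fun l ω => by
      rw [norm_smul, Real.norm_of_nonneg hθ]
      have := norm_sub_le (Y l ω) (∫ ω, Y l ω ∂P)
      nlinarith [hb l ω, hEn l])
    (fun l => by
      rw [integral_smul, integral_sub (hi l) (integrable_const _)]; simp)
    (fun l => by
      have e : ∀ ω, (θ • (Y l ω - ∫ ω, Y l ω ∂P)) * (θ • (Y l ω - ∫ ω, Y l ω ∂P)) =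
          (θ ^ 2) • ((Y l ω - ∫ ω, Y l ω ∂P) * (Y l ω - ∫ ω, Y l ω ∂P)) := fun ω => by
        rw [smul_mul_smul_comm, pow_two]
      simp_rw [e]
      rw [integral_smul, hsq]
      have h1 : ((V : ℂ) • (1 : Matrix n n ℂ) - ∫ ω, Y l ω * Y l ω ∂P).PosSemidef := by
        refine PosSemidef.of_dotProduct_mulVec_nonneg ?_ fun u => ?_
        · refine Matrix.IsHermitian.sub ?_ (integral_isHermitian fun ω => ?_)
          · unfold Matrix.IsHermitian; rw [conjTranspose_smul]; simp
          · have := isHermitian_conjTranspose_mul_self (Y l ω)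
            rwa [(hh l ω).eq] at this
        · have e2 : star u ⬝ᵥ (∫ ω, Y l ω * Y l ω ∂P) *ᵥ u =
              ((∫ ω, ∑ i, ‖(Y l ω *ᵥ u) i‖ ^ 2 ∂P : ℝ) : ℂ) := by
            rw [← integral_dotProduct_mulVec (hi2 l), ← integral_complex_ofReal]
            refine integral_congr_ae (Filter.Eventually.of_forall fun ω => ?_)
            simp only
            rw [← star_dotProduct_self_eq_sum, star_mulVec, (hh l ω).eq, ← dotProduct_mulVec,
              mulVec_mulVec]
          rw [sub_mulVec, dotProduct_sub, e2, smul_mulVec, one_mulVec, dotProduct_smul,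
            star_dotProduct_self_eq_sum, smul_eq_mul, ← Complex.ofReal_mul, ← Complex.ofReal_sub]
          exact Complex.zero_le_real.2 (sub_nonneg.2 (hvar l u))
      have h2 : ((∫ ω, Y l ω ∂P) * ∫ ω, Y l ω ∂P).PosSemidef := by
        have := posSemidef_conjTranspose_mul_self (∫ ω, Y l ω ∂P)
        rwa [(hEh l).eq] at this
      -- Centring only decreases the second moment: the subtracted `(E Y)²` is positive
      -- semidefinite.
      have h3 := (h1.add h2).smul (sq_nonneg θ)
      convert! h3 using 1
      ext i j
      simp
      ring)
    (θ * r)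
  refine le_trans (measureReal_mono fun ω hω => ?_) key
  simp only [Set.mem_ofPred_eq] at hω ⊢
  rw [← Finset.smul_sum, norm_smul, Real.norm_of_nonneg hθ]
  exact mul_le_mul_of_nonneg_left hω hθ

end CenteredBernstein

end CodedDiffraction

namespace CodedDiffraction

/-! ### Fourier orthogonality, measurement matrices and tangent vectors -/

section Deterministic

open Matrix

variable {d : ℕ}

/-- The coefficient `f_k^* D v` of the modulated vector `D v`. -/
noncomputable def fourierCoeff (a : Fin d → ℝ) (k : Fin d) (v : Fin d → ℂ) : ℂ :=
  ∑ i, star (fourierVec d k i) * v i * a i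

/-- The weighted sum `∑_k c_k F_k` of measurement matrices. -/
noncomputable def weightedMeas (c : Fin d → ℂ) (a : Fin d → ℝ) : Matrix (Fin d) (Fin d) ℂ :=
  ∑ k, c k • measMatrix a k

/-- The root of unity `ω = exp (2πi/d)`. -/
noncomputable def rootOfUnity (d : ℕ) : ℂ := Complex.exp (2 * Real.pi * Complex.I / d)

theorem norm_rootOfUnity (d : ℕ) : ‖rootOfUnity d‖ = 1 := by
  have : (2 * Real.pi * Complex.I / d : ℂ) = ((2 * Real.pi / d : ℝ) : ℂ) * Complex.I := by
    push_cast; ring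
  rw [rootOfUnity, this, Complex.norm_exp_ofReal_mul_I]

theorem rootOfUnity_ne_zero (d : ℕ) : rootOfUnity d ≠ 0 := Complex.exp_ne_zero _

theorem fourierVec_eq_zpow (k i : Fin d) :
    fourierVec d k i = rootOfUnity d ^ (((i : ℤ) + 1) * ((k : ℤ) + 1)) := by
  rw [fourierVec, ← rootOfUnity, ← zpow_natCast]
  push_cast
  rfl

theorem star_fourierVec_eq_zpow (k i : Fin d) :
    star (fourierVec d k i) = rootOfUnity d ^ (-((i : ℤ) + 1) * ((k : ℤ) + 1)) := by
  rw [fourierVec_eq_zpow, star_zpow₀, neg_mul, _root_.zpow_neg, ← _root_.inv_zpow]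
  congr 1
  rw [Complex.inv_eq_conj (norm_rootOfUnity d)]
  rfl

theorem norm_fourierVec (k i : Fin d) : ‖fourierVec d k i‖ = 1 := by
  rw [fourierVec_eq_zpow, norm_zpow, norm_rootOfUnity, _root_.one_zpow]

theorem sum_rootOfUnity_zpow (hd : d ≠ 0) (s : ℤ) :
    ∑ k : Fin d, rootOfUnity d ^ (s * ((k : ℤ) + 1)) = if (d : ℤ) ∣ s then (d : ℂ) else 0 := by
  have hp : IsPrimitiveRoot (rootOfUnity d) d := Complex.isPrimitiveRoot_exp d hd
  have e : ∀ k : Fin d, rootOfUnity d ^ (s * ((k : ℤ) + 1)) =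
      rootOfUnity d ^ s * (rootOfUnity d ^ s) ^ (k : ℕ) := fun k => by
    rw [← zpow_natCast, ← _root_.zpow_mul, ← zpow_add₀ (rootOfUnity_ne_zero d)]; ring_nf
  simp_rw [e]
  rw [← Finset.mul_sum, Fin.sum_univ_eq_sum_range (fun k => (rootOfUnity d ^ s) ^ k)]
  split_ifs with h
  · rw [(hp.zpow_eq_one_iff_dvd s).2 h]; simp
  · have h1 : rootOfUnity d ^ s ≠ 1 := fun h' => h ((hp.zpow_eq_one_iff_dvd s).1 h')
    rw [geom_sum_eq h1, ← zpow_natCast, ← _root_.zpow_mul, mul_comm s, _root_.zpow_mul, zpow_natCast,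
      hp.pow_eq_one, _root_.one_zpow, sub_self, zero_div, mul_zero]

theorem natCast_dvd_sub_iff {i j : Fin d} : (d : ℤ) ∣ (i : ℤ) - j ↔ i = j := by
  constructor
  · intro h
    have h1 := Int.eq_zero_of_abs_lt_dvd h (by rw [abs_lt]; constructor <;> omega)
    ext; omega
  · rintro rfl; simp

theorem sum_fourierVec_mul_star (hd : d ≠ 0) (i j : Fin d) :
    ∑ k, fourierVec d k i * star (fourierVec d k j) = if i = j then (d : ℂ) else 0 := by
  have e : ∀ k : Fin d, fourierVec d k i * star (fourierVec d k j) =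
      rootOfUnity d ^ (((i : ℤ) - j) * ((k : ℤ) + 1)) := fun k => by
    rw [fourierVec_eq_zpow, star_fourierVec_eq_zpow, ← zpow_add₀ (rootOfUnity_ne_zero d)]; ring_nf
  simp_rw [e, sum_rootOfUnity_zpow hd, natCast_dvd_sub_iff]

/-- This congruence is all that the sum over `k` retains of the Fourier structure; it selects the
index quadruples in the expectation. -/
theorem sum_fourierVec_four (hd : d ≠ 0) (i j m n : Fin d) :
    ∑ k, fourierVec d k i * star (fourierVec d k j) *
      (star (fourierVec d k n) * fourierVec d k m) =
      if (d : ℤ) ∣ (i : ℤ) - j + (m - n) then (d : ℂ) else 0 := by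
  have e : ∀ k : Fin d, fourierVec d k i * star (fourierVec d k j) *
      (star (fourierVec d k n) * fourierVec d k m) =
      rootOfUnity d ^ (((i : ℤ) - j + (m - n)) * ((k : ℤ) + 1)) := fun k => by
    rw [fourierVec_eq_zpow, star_fourierVec_eq_zpow, star_fourierVec_eq_zpow, fourierVec_eq_zpow,
      ← zpow_add₀ (rootOfUnity_ne_zero d), ← zpow_add₀ (rootOfUnity_ne_zero d),
      ← zpow_add₀ (rootOfUnity_ne_zero d)]
    ring_nf
  simp_rw [e, sum_rootOfUnity_zpow hd]

/-- The Fourier matrix, with columns `f_k`. -/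
noncomputable def fourierMatrix (d : ℕ) : Matrix (Fin d) (Fin d) ℂ :=
  Matrix.of fun i k => fourierVec d k i

theorem fourierMatrix_transpose (d : ℕ) : (fourierMatrix d)ᵀ = fourierMatrix d := by
  ext i k
  simp only [fourierMatrix, transpose_apply, of_apply, fourierVec, mul_comm]

theorem fourierMatrix_mul_conjTranspose (hd : d ≠ 0) :
    fourierMatrix d * (fourierMatrix d)ᴴ = (d : ℂ) • (1 : Matrix (Fin d) (Fin d) ℂ) := by
  ext i j
  simp only [mul_apply, conjTranspose_apply, fourierMatrix, of_apply, sum_fourierVec_mul_star hd,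
    Matrix.smul_apply, one_apply, smul_eq_mul, mul_ite, mul_one, mul_zero]

/-- Transpose the row orthogonality; the Fourier matrix is symmetric. -/
theorem conjTranspose_fourierMatrix_mul (hd : d ≠ 0) :
    (fourierMatrix d)ᴴ * fourierMatrix d = (d : ℂ) • (1 : Matrix (Fin d) (Fin d) ℂ) := by
  have h := congrArg transpose (fourierMatrix_mul_conjTranspose hd)
  rw [transpose_mul, fourierMatrix_transpose, conjTranspose, transpose_map, transpose_transpose,
    transpose_smul, transpose_one] at h
  rw [conjTranspose, fourierMatrix_transpose]
  exact h

theorem sum_norm_sq_mulVec {n : Type*} [Fintype n] [DecidableEq n] {M : Matrix n n ℂ} {c : ℝ}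
    (hM : Mᴴ * M = (c : ℂ) • 1) (u : n → ℂ) :
    ∑ i, ‖(M *ᵥ u) i‖ ^ 2 = c * ∑ i, ‖u i‖ ^ 2 := by
  have h := star_dotProduct_self_eq_sum (M *ᵥ u)
  rw [star_mulVec, ← dotProduct_mulVec, mulVec_mulVec, hM, smul_mulVec, one_mulVec,
    dotProduct_smul, star_dotProduct_self_eq_sum, smul_eq_mul, ← Complex.ofReal_mul,
    Complex.ofReal_inj] at h
  exact h.symm

theorem fourierCoeff_eq (a : Fin d → ℝ) (v : Fin d → ℂ) :
    (fun k => fourierCoeff a k v) = (fourierMatrix d)ᴴ *ᵥ fun i => v i * a i := by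
  ext k
  simp only [fourierCoeff, mulVec, dotProduct, conjTranspose_apply, fourierMatrix, of_apply,
    mul_assoc]

theorem sum_norm_sq_mul_le {a : Fin d → ℝ} {b : ℝ} (ha : ∀ i, |a i| ≤ b) (v : Fin d → ℂ) :
    ∑ i, ‖v i * a i‖ ^ 2 ≤ b ^ 2 * ∑ i, ‖v i‖ ^ 2 := by
  rw [Finset.mul_sum]
  refine Finset.sum_le_sum fun i _ => ?_
  rw [norm_mul, mul_pow, mul_comm, Complex.norm_real]
  exact mul_le_mul_of_nonneg_right (pow_le_pow_left₀ (norm_nonneg _) (ha i) 2) (by positivity)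

theorem sum_norm_sq_fourierCoeff_le (hd : d ≠ 0) {a : Fin d → ℝ} {b : ℝ} (ha : ∀ i, |a i| ≤ b)
    (v : Fin d → ℂ) : ∑ k, ‖fourierCoeff a k v‖ ^ 2 ≤ d * (b ^ 2 * ∑ i, ‖v i‖ ^ 2) := by
  have h := sum_norm_sq_mulVec (M := (fourierMatrix d)ᴴ) (c := d)
    (by rw [conjTranspose_conjTranspose, fourierMatrix_mul_conjTranspose hd]; simp)
    (fun i => v i * a i)
  rw [← fourierCoeff_eq] at h
  rw [h]
  exact mul_le_mul_of_nonneg_left (sum_norm_sq_mul_le ha v) (Nat.cast_nonneg d)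

theorem measMatrix_apply (a : Fin d → ℝ) (k i j : Fin d) :
    measMatrix a k i j = fourierVec d k i * star (fourierVec d k j) * (a i * a j) := by
  rw [measMatrix, maskMatrix, mul_diagonal, diagonal_mul, outer, vecMulVec_apply, Pi.star_apply]
  ring

theorem measMatrix_isHermitian (a : Fin d → ℝ) (k : Fin d) : (measMatrix a k).IsHermitian := by
  ext i j
  rw [conjTranspose_apply, measMatrix_apply, measMatrix_apply]
  simp only [star_mul', Complex.star_def, Complex.conj_ofReal, Complex.conj_conj]
  ring

theorem measMatrix_mulVec (a : Fin d → ℝ) (k : Fin d) (v : Fin d → ℂ) (i : Fin d) :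
    (measMatrix a k *ᵥ v) i = fourierCoeff a k v * fourierVec d k i * a i := by
  simp only [mulVec, dotProduct, measMatrix_apply, fourierCoeff, Finset.sum_mul]
  exact Finset.sum_congr rfl fun j _ => by ring

theorem star_fourierCoeff (a : Fin d → ℝ) (k : Fin d) (v : Fin d → ℂ) :
    star (fourierCoeff a k v) = ∑ i, star (v i) * (fourierVec d k i * a i) := by
  rw [fourierCoeff, star_sum]
  refine Finset.sum_congr rfl fun i _ => ?_
  simp only [star_mul', Complex.star_def, Complex.conj_ofReal, Complex.conj_conj]
  ring

theorem star_dotProduct_measMatrix_mulVec (a : Fin d → ℝ) (k : Fin d) (u v : Fin d → ℂ) :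
    star u ⬝ᵥ measMatrix a k *ᵥ v = star (fourierCoeff a k u) * fourierCoeff a k v := by
  rw [star_fourierCoeff, dotProduct, Finset.sum_mul]
  refine Finset.sum_congr rfl fun i _ => ?_
  rw [measMatrix_mulVec, Pi.star_apply]
  ring

theorem trace_measMatrix_mul_outer (a : Fin d → ℝ) (k : Fin d) (u v : Fin d → ℂ) :
    (measMatrix a k * outer u v).trace = fourierCoeff a k u * star (fourierCoeff a k v) := by
  rw [outer, mul_vecMulVec, trace_vecMulVec, dotProduct_comm, star_dotProduct_measMatrix_mulVec, mul_comm]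

theorem weightedMeas_mulVec (c : Fin d → ℂ) (a : Fin d → ℝ) (v : Fin d → ℂ) (i : Fin d) :
    (weightedMeas c a *ᵥ v) i =
      (fourierMatrix d *ᵥ fun k => c k * fourierCoeff a k v) i * a i := by
  rw [weightedMeas, sum_mulVec, Finset.sum_apply]
  simp only [smul_mulVec, Pi.smul_apply, measMatrix_mulVec, smul_eq_mul]
  simp only [mulVec, dotProduct, Finset.sum_mul, fourierMatrix, of_apply]
  exact Finset.sum_congr rfl fun k _ => by ring

/-- The weighted sum acts as mask times Fourier matrix on the vector of products `c_k f_k^* D v`.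
The Fourier matrix is `√d` times a unitary, so no cross terms between different `k` appear; this
keeps both the norm and the variance of a summand small. -/
theorem sum_norm_sq_weightedMeas_mulVec_le (hd : d ≠ 0) {a : Fin d → ℝ} {b : ℝ}
    (ha : ∀ i, |a i| ≤ b) (c : Fin d → ℂ) (v : Fin d → ℂ) :
    ∑ i, ‖(weightedMeas c a *ᵥ v) i‖ ^ 2 ≤
      b ^ 2 * (d * ∑ k, ‖c k‖ ^ 2 * ‖fourierCoeff a k v‖ ^ 2) := by
  have h := sum_norm_sq_mulVec (M := fourierMatrix d) (c := d)
    (by rw [conjTranspose_fourierMatrix_mul hd]; simp) (fun k => c k * fourierCoeff a k v)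
  simp only [norm_mul (c _), mul_pow] at h
  rw [← h]
  simp only [weightedMeas_mulVec]
  exact sum_norm_sq_mul_le ha _

section

open scoped Matrix.Norms.L2Operator

theorem norm_weightedMeas_le (hd : d ≠ 0) {a : Fin d → ℝ} {b τ : ℝ} (hτ : 0 ≤ τ)
    (ha : ∀ i, |a i| ≤ b) {c : Fin d → ℂ} (hc : ∀ k, ‖c k‖ ≤ τ) :
    ‖weightedMeas c a‖ ≤ d * b ^ 2 * τ := by
  refine opNorm_le_of_sum_le (by positivity) fun v => ?_
  refine (sum_norm_sq_weightedMeas_mulVec_le hd ha c v).trans ?_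
  have h1 : ∑ k, ‖c k‖ ^ 2 * ‖fourierCoeff a k v‖ ^ 2 ≤ τ ^ 2 * ∑ k, ‖fourierCoeff a k v‖ ^ 2 := by
    rw [Finset.mul_sum]
    exact Finset.sum_le_sum fun k _ => mul_le_mul_of_nonneg_right
      (pow_le_pow_left₀ (norm_nonneg _) (hc k) 2) (by positivity)
  calc _ ≤ b ^ 2 * (d * (τ ^ 2 * (d * (b ^ 2 * ∑ i, ‖v i‖ ^ 2)))) := by
        gcongr
        exact h1.trans (mul_le_mul_of_nonneg_left (sum_norm_sq_fourierCoeff_le hd ha v)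
          (sq_nonneg τ))
    _ = _ := by ring

theorem weightedMeas_isHermitian {c : Fin d → ℂ} (hc : ∀ k, star (c k) = c k) (a : Fin d → ℝ) :
    (weightedMeas c a).IsHermitian := by
  refine isSelfAdjoint_sum _ fun k _ => ?_
  change (c k • measMatrix a k)ᴴ = _
  rw [conjTranspose_smul, hc, (measMatrix_isHermitian a k).eq]

end

section

open scoped Matrix.Norms.Frobenius

theorem frobNorm_sq (Z : Matrix (Fin d) (Fin d) ℂ) :
    frobNorm Z ^ 2 = ∑ i, ∑ j, ‖Z i j‖ ^ 2 := by
  have h : frobNorm Z = (∑ i, ∑ j, ‖Z i j‖ ^ (2 : ℝ)) ^ (1 / 2 : ℝ) := frobenius_norm_def Z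
  rw [h, ← Real.sqrt_eq_rpow, Real.sq_sqrt (by positivity)]
  norm_cast

theorem frobNorm_nonneg (Z : Matrix (Fin d) (Fin d) ℂ) : 0 ≤ frobNorm Z := norm_nonneg Z

theorem frobNorm_pos {Z : Matrix (Fin d) (Fin d) ℂ} (hZ : Z ≠ 0) : 0 < frobNorm Z :=
  norm_pos_iff.2 hZ

end

theorem frobNorm_sq_tangent {x w : Fin d → ℂ} (hx : ∑ i, ‖x i‖ ^ 2 = 1) :
    frobNorm (outer x w + outer w x) ^ 2 =
      2 * ∑ i, ‖w i‖ ^ 2 + 2 * ((∑ i, x i * star (w i)) ^ 2).re := by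
  have e : ∀ i j, ‖(outer x w + outer w x) i j‖ ^ 2 = ‖x i‖ ^ 2 * ‖w j‖ ^ 2 +
      ‖w i‖ ^ 2 * ‖x j‖ ^ 2 + 2 * ((x i * star (w i)) * (x j * star (w j))).re := fun i j => by
    rw [Matrix.add_apply, outer, outer, vecMulVec_apply, vecMulVec_apply, Complex.sq_norm,
      Complex.normSq_add, Complex.normSq_mul, Complex.normSq_mul]
    simp only [Complex.sq_norm, Pi.star_apply, Complex.star_def, Complex.normSq_conj, map_mul,
      Complex.conj_conj]
    congr 3
    ring
  rw [frobNorm_sq]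
  simp only [e, Finset.sum_add_distrib, ← Finset.mul_sum, ← Complex.re_sum, ← Finset.sum_mul, hx,
    pow_two (∑ i, x i * star (w i))]
  ring

/-- A tangent vector is `x w^* + w x^*` for some `w` controlled by its Frobenius norm. -/
theorem exists_tangent_vector {x : Fin d → ℂ} (hx : ∑ i, ‖x i‖ ^ 2 = 1)
    {Z : Matrix (Fin d) (Fin d) ℂ} (hZ : Z ∈ tangentSpace x) :
    ∃ w : Fin d → ℂ, Z = outer x w + outer w x ∧ 2 * ∑ i, ‖w i‖ ^ 2 ≤ frobNorm Z ^ 2 := by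
  obtain ⟨z, rfl⟩ := hZ
  set β : ℂ := ∑ i, x i * star (z i) with hβ
  have hxx : ∑ i, x i * star (x i) = 1 := by
    have h : ∀ i, x i * star (x i) = ((‖x i‖ ^ 2 : ℝ) : ℂ) := fun i => by
      simpa using Complex.mul_conj' (x i)
    simp_rw [h]
    rw [← Complex.ofReal_sum, hx, Complex.ofReal_one]
  -- Adding an imaginary multiple of `x` to `z` does not change `Z`. The chosen multiple makes the
  -- inner product with `x` real, so its square contributes nonnegatively to the Frobenius norm.
  have hw : outer x z + outer z x = outer x (fun i => z i + (β.im * Complex.I) * x i) +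
      outer (fun i => z i + (β.im * Complex.I) * x i) x := by
    ext i j
    simp only [Matrix.add_apply, outer, vecMulVec_apply, Pi.star_apply, star_add, star_mul',
      Complex.star_def, Complex.conj_ofReal, Complex.conj_I]
    ring
  refine ⟨_, hw, ?_⟩
  rw [hw, frobNorm_sq_tangent hx]
  have h1 : ∑ i, x i * star (z i + (β.im * Complex.I) * x i) = (β.re : ℂ) := by
    have e : ∀ i, x i * star (z i + (β.im * Complex.I) * x i) =
        x i * star (z i) - β.im * Complex.I * (x i * star (x i)) := fun i => by
      simp only [star_add, star_mul', Complex.star_def, Complex.conj_ofReal, Complex.conj_I]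
      ring
    simp_rw [e]
    rw [Finset.sum_sub_distrib, ← Finset.mul_sum, hxx, ← hβ, mul_one]
    exact sub_eq_of_eq_add (Complex.re_add_im β).symm
  rw [h1, ← Complex.ofReal_pow, Complex.ofReal_re]
  nlinarith [sq_nonneg β.re]

theorem norm_trace_measMatrix_mul_le (a : Fin d → ℝ) (k : Fin d) (x w : Fin d → ℂ) :
    ‖(measMatrix a k * (outer x w + outer w x)).trace‖ ≤
      2 * (‖fourierCoeff a k x‖ * ‖fourierCoeff a k w‖) := by
  rw [mul_add, trace_add, trace_measMatrix_mul_outer, trace_measMatrix_mul_outer]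
  refine (norm_add_le _ _).trans_eq ?_
  rw [norm_mul, norm_mul, norm_star, norm_star]
  ring

theorem star_trace_measMatrix_mul (a : Fin d → ℝ) (k : Fin d) (x w : Fin d → ℂ) :
    star (measMatrix a k * (outer x w + outer w x)).trace =
      (measMatrix a k * (outer x w + outer w x)).trace := by
  rw [mul_add, trace_add, trace_measMatrix_mul_outer, trace_measMatrix_mul_outer]
  simp only [star_add, star_mul', star_star]
  ring

end Deterministic

end CodedDiffraction

namespace CodedDiffraction

/-! ### Subgaussian tails and eighth moments of the Fourier coefficients -/

section Pattern

open Matrix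

variable {d : ℕ} {Ω : Type*} [MeasurableSpace Ω]

/-- A random modulation pattern with independent entries that are bounded by `b`, of mean `0`,
second moment `ν` and fourth moment `2ν²`. -/
structure IsPattern (P : Measure Ω) (b ν : ℝ) (a : Fin d → Ω → ℝ) : Prop where
  measurable : ∀ i, Measurable (a i)
  abs_le : ∀ i ω, |a i ω| ≤ b
  indep : iIndepFun a P
  mean : ∀ i, ∫ ω, a i ω ∂P = 0
  second : ∀ i, ∫ ω, a i ω ^ 2 ∂P = ν
  fourth : ∀ i, ∫ ω, a i ω ^ 4 ∂P = 2 * ν ^ 2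

variable {P : Measure Ω} {b ν : ℝ} {a : Fin d → Ω → ℝ}

theorem IsPattern.measurable_fourierCoeff (h : IsPattern P b ν a) (k : Fin d) (v : Fin d → ℂ) :
    Measurable fun ω => fourierCoeff (fun i => a i ω) k v := by
  have := h.measurable
  unfold fourierCoeff
  fun_prop

variable [IsProbabilityMeasure P]

/-- Hoeffding's lemma for each centred term in `[-|c_i| b, |c_i| b]`; variance proxies add under
independence. -/
theorem IsPattern.hasSubgaussianMGF (h : IsPattern P b ν a) (c : Fin d → ℝ) :
    ∃ s : NNReal, (s : ℝ) = b ^ 2 * ∑ i, c i ^ 2 ∧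
      HasSubgaussianMGF (fun ω => ∑ i, c i * a i ω) s P := by
  have h1 : ∀ i, HasSubgaussianMGF (fun ω => c i * a i ω)
      ((‖|c i| * b - -(|c i| * b)‖₊ / 2) ^ 2) P := fun i => by
    refine hasSubgaussianMGF_of_mem_Icc_of_integral_eq_zero
      ((h.measurable i).const_mul _).aemeasurable (Filter.Eventually.of_forall fun ω => ?_) ?_
    · rw [Set.mem_Icc, ← _root_.abs_le, abs_mul]
      exact mul_le_mul_of_nonneg_left (h.abs_le i ω) (abs_nonneg _)
    · rw [integral_const_mul, h.mean, mul_zero]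
  refine ⟨_, ?_, HasSubgaussianMGF.sum_of_iIndepFun
    (h.indep.comp (fun i y => c i * y) fun i => measurable_const_mul _) (s := Finset.univ)
    fun i _ => h1 i⟩
  push_cast
  rw [Finset.mul_sum]
  refine Finset.sum_congr rfl fun i _ => ?_
  rw [Real.norm_eq_abs, div_pow, sq_abs, ← sq_abs (c i)]
  ring

theorem IsPattern.measureReal_lt_sq_le (h : IsPattern P b ν a) (hb : 0 < b) (c : Fin d → ℝ) {u : ℝ}
    (hu : 0 ≤ u) :
    P.real {ω | 2 * b ^ 2 * u * ∑ i, c i ^ 2 < (∑ i, c i * a i ω) ^ 2} ≤ 2 * Real.exp (-u) := by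
  obtain ⟨s, hs, hX⟩ := h.hasSubgaussianMGF c
  rcases (Finset.sum_nonneg fun i _ => sq_nonneg (c i) : 0 ≤ ∑ i, c i ^ 2).eq_or_lt with h0 | h0
  · have hc : ∀ i, c i = 0 := fun i => by
      have := (Finset.sum_eq_zero_iff_of_nonneg fun i _ => sq_nonneg (c i)).1 h0.symm i
        (Finset.mem_univ i)
      exact pow_eq_zero_iff two_ne_zero |>.1 this
    simp [hc, (Real.exp_pos _).le]
  · set e := √(2 * b ^ 2 * u * ∑ i, c i ^ 2) with he
    have he2 : e ^ 2 = 2 * b ^ 2 * u * ∑ i, c i ^ 2 := Real.sq_sqrt (by positivity)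
    have hexp : -e ^ 2 / (2 * s) = -u := by rw [he2, hs]; field_simp
    have t1 := hX.measure_ge_le (Real.sqrt_nonneg _ : 0 ≤ e)
    have t2 := hX.neg.measure_ge_le (Real.sqrt_nonneg _ : 0 ≤ e)
    rw [hexp] at t1 t2
    have hsub : {ω | 2 * b ^ 2 * u * ∑ i, c i ^ 2 < (∑ i, c i * a i ω) ^ 2} ⊆
        {ω | e ≤ ∑ i, c i * a i ω} ∪ {ω | e ≤ (-fun ω => ∑ i, c i * a i ω) ω} := fun ω hω => by
      have h3 : e ≤ |∑ i, c i * a i ω| := by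
        refine abs_le_of_sq_le_sq' ?_ (abs_nonneg _) |>.2
        rw [he2, sq_abs]
        exact (Set.mem_ofPred.1 hω).le
      exact le_abs.1 h3
    calc _ ≤ _ := measureReal_mono hsub
      _ ≤ _ := measureReal_union_le _ _
      _ ≤ _ := by linarith

theorem pow_eight_le (y : ℝ) : y ^ 8 ≤ 40320 * (Real.exp y + Real.exp (-y)) := by
  have h := Real.pow_div_factorial_le_exp |y| (abs_nonneg y) 8
  have h8 : |y| ^ 8 = y ^ 8 := by rw [← abs_pow]; exact abs_of_nonneg (by positivity)
  have hf : ((Nat.factorial 8 : ℕ) : ℝ) = 40320 := by norm_num [Nat.factorial]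
  rw [h8, hf, div_le_iff₀ (by norm_num)] at h
  have : Real.exp |y| ≤ Real.exp y + Real.exp (-y) := by
    rcases abs_cases y with h' | h' <;> rw [h'.1]
    · exact le_add_of_nonneg_right (Real.exp_pos _).le
    · exact le_add_of_nonneg_left (Real.exp_pos _).le
  linarith

theorem IsPattern.integral_pow_eight_le (h : IsPattern P b ν a) (hb : 0 < b) {c : Fin d → ℝ}
    (hc : ∑ i, c i ^ 2 ≤ 1) : ∫ ω, (∑ i, c i * a i ω) ^ 8 ∂P ≤ 161280 * b ^ 8 := by
  obtain ⟨s, hs, hX⟩ := h.hasSubgaussianMGF c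
  set X : Ω → ℝ := fun ω => ∑ i, c i * a i ω with hXdef
  -- At `t = ±1/b` the moment generating function is at most `exp (1/2) ≤ 2`. The two signs and `8!
  -- = 40320` give `161280 = 4 * 40320`.
  have hmgf : ∀ t : ℝ, t ^ 2 = (b⁻¹) ^ 2 → ∫ ω, Real.exp (t * X ω) ∂P ≤ 2 := fun t ht => by
    refine (hX.mgf_le t).trans ?_
    rw [hs, ht]
    have e : b ^ 2 * (∑ i, c i ^ 2) * b⁻¹ ^ 2 / 2 ≤ 1 / 2 := by
      have : b ^ 2 * (∑ i, c i ^ 2) * b⁻¹ ^ 2 = ∑ i, c i ^ 2 := by field_simp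
      rw [this]; linarith
    refine (Real.exp_le_exp.2 e).trans ?_
    have h1 : Real.exp (1 / 2) ^ 2 = Real.exp 1 := by rw [← Real.exp_nat_mul]; norm_num
    have := Real.exp_one_lt_d9
    nlinarith [Real.exp_pos (1 / 2 : ℝ)]
  have i1 := hX.integrable_exp_mul b⁻¹
  have i2 := hX.integrable_exp_mul (-b⁻¹)
  have hpt : ∀ ω, X ω ^ 8 ≤ b ^ 8 * (40320 * (Real.exp (b⁻¹ * X ω) + Real.exp (-b⁻¹ * X ω))) := by
    intro ω
    have h1 := pow_eight_le (b⁻¹ * X ω)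
    rw [← neg_mul] at h1
    have h2 : X ω ^ 8 = b ^ 8 * (b⁻¹ * X ω) ^ 8 := by field_simp
    rw [h2]
    exact mul_le_mul_of_nonneg_left h1 (by positivity)
  have hi : Integrable (fun ω => b ^ 8 * (40320 * (Real.exp (b⁻¹ * X ω) +
      Real.exp (-b⁻¹ * X ω)))) P := ((i1.add i2).const_mul _).const_mul _
  refine (integral_mono_of_nonneg (Filter.Eventually.of_forall fun ω => by positivity) hi
    (Filter.Eventually.of_forall hpt)).trans ?_
  rw [integral_const_mul, integral_const_mul, integral_add i1 i2]
  have := hmgf b⁻¹ rfl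
  have := hmgf (-b⁻¹) (by ring)
  have hb8 : 0 < b ^ 8 := by positivity
  nlinarith

theorem fourierCoeff_eq_re_add_im (k : Fin d) (v : Fin d → ℂ) (m : Fin d → ℝ) :
    ‖fourierCoeff m k v‖ ^ 2 = (∑ i, (star (fourierVec d k i) * v i).re * m i) ^ 2 +
      (∑ i, (star (fourierVec d k i) * v i).im * m i) ^ 2 := by
  rw [Complex.sq_norm, Complex.normSq_apply, fourierCoeff, Complex.re_sum, Complex.im_sum]
  simp only [Complex.re_mul_ofReal, Complex.im_mul_ofReal, pow_two]

theorem sum_re_sq_add_sum_im_sq (k : Fin d) (v : Fin d → ℂ) :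
    ∑ i, (star (fourierVec d k i) * v i).re ^ 2 + ∑ i, (star (fourierVec d k i) * v i).im ^ 2 =
      ∑ i, ‖v i‖ ^ 2 := by
  rw [← Finset.sum_add_distrib]
  refine Finset.sum_congr rfl fun i _ => ?_
  have h : ‖star (fourierVec d k i) * v i‖ ^ 2 = ‖v i‖ ^ 2 := by
    rw [norm_mul, norm_star, norm_fourierVec, one_mul]
  rw [← h, Complex.sq_norm, Complex.normSq_apply]
  ring

/-- The threshold is shared between real and imaginary part in proportion to their coefficient
masses, which sum to at most 1; one part must exceed its share, so splitting does not weaken the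
exponent. -/
theorem IsPattern.measureReal_lt_norm_sq_le (h : IsPattern P b ν a) (hb : 0 < b) (k : Fin d)
    {v : Fin d → ℂ} (hv : ∑ i, ‖v i‖ ^ 2 ≤ 1) {u : ℝ} (hu : 0 ≤ u) :
    P.real {ω | 2 * b ^ 2 * u < ‖fourierCoeff (fun i => a i ω) k v‖ ^ 2} ≤ 4 * Real.exp (-u) := by
  have t1 := h.measureReal_lt_sq_le hb (fun i => (star (fourierVec d k i) * v i).re) hu
  have t2 := h.measureReal_lt_sq_le hb (fun i => (star (fourierVec d k i) * v i).im) hu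
  have hsum := sum_re_sq_add_sum_im_sq k v
  refine (measureReal_mono fun ω hω => ?_).trans ((measureReal_union_le _ _).trans
    ((add_le_add t1 t2).trans_eq (by ring)))
  simp only [Set.mem_ofPred_eq, Set.mem_union, fourierCoeff_eq_re_add_im] at hω ⊢
  by_contra! hcon
  have : 2 * b ^ 2 * u * ∑ i, ‖v i‖ ^ 2 ≤ 2 * b ^ 2 * u := mul_le_of_le_one_right (by positivity) hv
  rw [← hsum] at this
  linarith [hcon.1, hcon.2]

theorem IsPattern.integral_norm_pow_eight_le (h : IsPattern P b ν a) (hb : 0 < b) (k : Fin d)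
    {v : Fin d → ℂ} (hv : ∑ i, ‖v i‖ ^ 2 ≤ 1) :
    ∫ ω, ‖fourierCoeff (fun i => a i ω) k v‖ ^ 8 ∂P ≤ 2580480 * b ^ 8 := by
  have hsum := sum_re_sq_add_sum_im_sq k v
  have hint : ∀ c : Fin d → ℝ, Integrable (fun ω => (∑ i, c i * a i ω) ^ 8) P := fun c => by
    have hm := h.measurable
    refine Integrable.of_bound (by fun_prop) ((∑ i, |c i| * b) ^ 8)
      (Filter.Eventually.of_forall fun ω => ?_)
    rw [norm_pow]
    refine pow_le_pow_left₀ (norm_nonneg _) ((norm_sum_le _ _).trans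
      (Finset.sum_le_sum fun i _ => ?_)) 8
    rw [norm_mul]
    exact mul_le_mul_of_nonneg_left (h.abs_le i ω) (abs_nonneg _)
  have t1 := h.integral_pow_eight_le hb (c := fun i => (star (fourierVec d k i) * v i).re)
    (by linarith [Finset.sum_nonneg fun i (_ : i ∈ Finset.univ) =>
      sq_nonneg (star (fourierVec d k i) * v i).im])
  have t2 := h.integral_pow_eight_le hb (c := fun i => (star (fourierVec d k i) * v i).im)
    (by linarith [Finset.sum_nonneg fun i (_ : i ∈ Finset.univ) =>
      sq_nonneg (star (fourierVec d k i) * v i).re])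
  have hpt : ∀ ω, ‖fourierCoeff (fun i => a i ω) k v‖ ^ 8 ≤
      8 * ((∑ i, (star (fourierVec d k i) * v i).re * a i ω) ^ 8 +
        (∑ i, (star (fourierVec d k i) * v i).im * a i ω) ^ 8) := fun ω => by
    have e : ‖fourierCoeff (fun i => a i ω) k v‖ ^ 8 =
      (‖fourierCoeff (fun i => a i ω) k v‖ ^ 2) ^ 4 := by ring
    rw [e, fourierCoeff_eq_re_add_im]
    refine (add_pow_le (by positivity) (by positivity) 4).trans_eq ?_
    ring
  refine (integral_mono_of_nonneg (Filter.Eventually.of_forall fun ω => by positivity)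
    (((hint _).add (hint _)).const_mul 8) (Filter.Eventually.of_forall hpt)).trans ?_
  rw [integral_const_mul]
  erw [integral_add (hint _) (hint _)]
  linarith

end Pattern

end CodedDiffraction

namespace CodedDiffraction

/-! ### Expectation of the untruncated operator -/

section Isotropy

open Matrix

variable {d : ℕ} {Ω : Type*} [MeasurableSpace Ω] {P : Measure Ω} {b ν : ℝ} {a : Fin d → Ω → ℝ}

theorem IsPattern.measurable_weightedMeas (h : IsPattern P b ν a) {c : Ω → Fin d → ℂ}
    (hc : ∀ k, Measurable fun ω => c ω k) :
    Measurable fun ω => weightedMeas (c ω) fun i => a i ω := by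
  have := h.measurable
  refine measurable_pi_iff.2 fun i => measurable_pi_iff.2 fun j => ?_
  simp only [weightedMeas, Matrix.sum_apply, Matrix.smul_apply, measMatrix_apply, smul_eq_mul]
  fun_prop

theorem IsPattern.measurable_trace (h : IsPattern P b ν a) (k : Fin d)
    (Z : Matrix (Fin d) (Fin d) ℂ) :
    Measurable fun ω => (measMatrix (fun i => a i ω) k * Z).trace := by
  have := h.measurable
  simp only [trace, diag_apply, mul_apply, measMatrix_apply]
  fun_prop

theorem norm_fourierCoeff_le {m : Fin d → ℝ} (hm : ∀ i, |m i| ≤ b) (k : Fin d) (v : Fin d → ℂ) :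
    ‖fourierCoeff m k v‖ ≤ b * ∑ i, ‖v i‖ := by
  rw [fourierCoeff, Finset.mul_sum]
  refine (norm_sum_le _ _).trans (Finset.sum_le_sum fun i _ => ?_)
  rw [norm_mul, norm_mul, norm_star, norm_fourierVec, one_mul, mul_comm, Complex.norm_real]
  exact mul_le_mul_of_nonneg_right (hm i) (norm_nonneg _)

theorem IsPattern.integral_sq_mul_sq (h : IsPattern P b ν a) {i m : Fin d} (him : i ≠ m) :
    ∫ ω, a i ω ^ 2 * a m ω ^ 2 ∂P = ν ^ 2 := by
  have hm := h.measurable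
  have hind : IndepFun (fun ω => a i ω ^ 2) (fun ω => a m ω ^ 2) P :=
    (h.indep.indepFun him).comp (φ := fun y => y ^ 2) (ψ := fun y => y ^ 2) (by fun_prop)
      (by fun_prop)
  rw [hind.integral_fun_mul_eq_mul_integral (by fun_prop) (by fun_prop), h.second, h.second, pow_two]

theorem IsPattern.integral_mul_eq_zero (h : IsPattern P b ν a) {j i m n : Fin d} (h1 : j ≠ i)
    (h2 : j ≠ m) (h3 : j ≠ n) : ∫ ω, a j ω * (a i ω * a m ω * a n ω) ∂P = 0 := by
  have hm := h.measurable
  have hdis : Disjoint ({j} : Finset (Fin d)) {i, m, n} := by simp [h1, h2, h3]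
  have hφ : Measurable fun y : ({j} : Finset (Fin d)) → ℝ => y ⟨j, by simp⟩ := by fun_prop
  have hψ : Measurable fun y : ({i, m, n} : Finset (Fin d)) → ℝ =>
      y ⟨i, by simp⟩ * y ⟨m, by simp⟩ * y ⟨n, by simp⟩ := by fun_prop
  have hind := (h.indep.indepFun_finset _ _ hdis hm).comp hφ hψ
  have := hind.integral_fun_mul_eq_mul_integral
    (Measurable.aestronglyMeasurable (by simp only [Function.comp_def]; fun_prop))
    (Measurable.aestronglyMeasurable (by simp only [Function.comp_def]; fun_prop))
  simp only [Function.comp_def] at this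
  rw [this, h.mean, zero_mul]

/-- Under the congruence, `i = j` forces `m = n` and `i = n` forces `m = j`. In every other case
some index occurs only once, so the mean-zero entry there kills the integral. -/
theorem IsPattern.integral_four (h : IsPattern P b ν a) (hd : Odd d) {i j m n : Fin d}
    (hdvd : (d : ℤ) ∣ (i : ℤ) - j + (m - n)) :
    ∫ ω, a i ω * a j ω * (a m ω * a n ω) ∂P =
      (if i = j ∧ m = n then ν ^ 2 else 0) + if i = n ∧ j = m then ν ^ 2 else 0 := by
  by_cases hij : i = j
  · subst hij
    have hmn : m = n := natCast_dvd_sub_iff.1 (by simpa using hdvd)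
    subst hmn
    by_cases him : i = m
    · subst him
      have e : ∀ ω, a i ω * a i ω * (a i ω * a i ω) = a i ω ^ 4 := fun ω => by ring
      -- When all four indices agree both pairings hold, and the fourth moment `2ν²` is exactly
      -- their sum.
      simp_rw [e, h.fourth]
      simp
      ring
    · have e : ∀ ω, a i ω * a i ω * (a m ω * a m ω) = a i ω ^ 2 * a m ω ^ 2 := fun ω => by ring
      simp_rw [e, h.integral_sq_mul_sq him]
      simp [him]
  · by_cases hin : i = n
    · subst hin
      have hmj : m = j := natCast_dvd_sub_iff.1 (by convert! hdvd using 1; ring)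
      subst hmj
      have e : ∀ ω, a i ω * a m ω * (a m ω * a i ω) = a i ω ^ 2 * a m ω ^ 2 := fun ω => by ring
      simp_rw [e, h.integral_sq_mul_sq hij]
      simp [hij]
    · simp only [hij, hin, false_and, if_false, add_zero]
      by_cases him : i = m
      · subst him
        have hjn : j ≠ n := by
          rintro rfl
          -- The third pairing `i = m, j = n` would mean `d ∣ 2 (i - j)`; oddness of `d` excludes
          -- it.
          have h2 : (d : ℤ) ∣ 2 * ((i : ℤ) - j) := by convert! hdvd using 1; ring
          have hcop : IsCoprime (d : ℤ) 2 := by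
            rw [Int.isCoprime_iff_gcd_eq_one]
            exact_mod_cast (Nat.coprime_two_right.2 hd)
          exact hij (natCast_dvd_sub_iff.1 (hcop.dvd_of_dvd_mul_left h2))
        rw [← h.integral_mul_eq_zero (Ne.symm hij) (Ne.symm hij) hjn]
        exact integral_congr_ae (Filter.Eventually.of_forall fun ω => by ring)
      · rw [← h.integral_mul_eq_zero hij him hin]
        exact integral_congr_ae (Filter.Eventually.of_forall fun ω => by ring)

open scoped Matrix.Norms.L2Operator

variable [IsProbabilityMeasure P]

/-- The expectation of the measurement operator without truncation. -/
theorem IsPattern.integral_weightedMeas_trace (h : IsPattern P b ν a) (hd : Odd d)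
    (Z : Matrix (Fin d) (Fin d) ℂ)
    (hint : Integrable (fun ω => weightedMeas
      (fun k => (measMatrix (fun i => a i ω) k * Z).trace) fun i => a i ω) P) :
    ∫ ω, weightedMeas (fun k => (measMatrix (fun i => a i ω) k * Z).trace) (fun i => a i ω) ∂P =
      ((ν ^ 2 * d : ℝ) : ℂ) • (Z + Z.trace • (1 : Matrix (Fin d) (Fin d) ℂ)) := by
  have hd0 : d ≠ 0 := hd.pos.ne'
  have hm := h.measurable
  ext i j
  rw [integral_matrix_apply hint]
  have e : ∀ ω, weightedMeas (fun k => (measMatrix (fun i => a i ω) k * Z).trace)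
      (fun i => a i ω) i j = ∑ m, ∑ n, (Z n m * if (d : ℤ) ∣ (i : ℤ) - j + (m - n) then (d : ℂ) else 0) *
        ((a i ω * a j ω * (a m ω * a n ω) : ℝ) : ℂ) := fun ω => by
    simp only [weightedMeas, Matrix.sum_apply, Matrix.smul_apply, measMatrix_apply, smul_eq_mul,
      trace, diag_apply, mul_apply, Finset.sum_mul]
    rw [Finset.sum_comm]
    refine Finset.sum_congr rfl fun m _ => ?_
    rw [Finset.sum_comm]
    refine Finset.sum_congr rfl fun n _ => ?_
    rw [← sum_fourierVec_four hd0, Finset.mul_sum, Finset.sum_mul]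
    refine Finset.sum_congr rfl fun k _ => ?_
    push_cast
    ring
  have hi : ∀ m n : Fin d, Integrable (fun ω => ((a i ω * a j ω * (a m ω * a n ω) : ℝ) : ℂ)) P :=
    fun m n => by
    refine Integrable.of_bound (by fun_prop) (b * b * (b * b)) (Filter.Eventually.of_forall fun ω => ?_)
    have hb : 0 ≤ b := (abs_nonneg _).trans (h.abs_le i ω)
    rw [Complex.norm_real, Real.norm_eq_abs, abs_mul, abs_mul, abs_mul]
    have := h.abs_le
    gcongr <;> exact h.abs_le _ ω
  simp_rw [e]
  rw [integral_finsetSum _ fun m _ => integrable_finsetSum _ fun n _ => (hi m n).const_mul _]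
  have e2 : ∀ m n : Fin d, ∫ ω, (Z n m * if (d : ℤ) ∣ (i : ℤ) - j + (m - n) then (d : ℂ) else 0) *
      ((a i ω * a j ω * (a m ω * a n ω) : ℝ) : ℂ) ∂P =
      (if i = j ∧ m = n then Z n m * d * ν ^ 2 else 0) +
        if i = n ∧ j = m then Z n m * d * ν ^ 2 else 0 := fun m n => by
    rw [integral_const_mul, integral_complex_ofReal]
    by_cases hdvd : (d : ℤ) ∣ (i : ℤ) - j + (m - n)
    · rw [if_pos hdvd, h.integral_four hd hdvd]
      split_ifs <;> push_cast <;> ring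
    · rw [if_neg hdvd, if_neg, if_neg]
      · rw [mul_zero, zero_mul, add_zero]
      · rintro ⟨rfl, rfl⟩; simp at hdvd
      · rintro ⟨rfl, rfl⟩; simp at hdvd
  have e3 : ∀ m : Fin d, ∫ ω, ∑ n, (Z n m * if (d : ℤ) ∣ (i : ℤ) - j + (m - n) then (d : ℂ) else 0) *
      ((a i ω * a j ω * (a m ω * a n ω) : ℝ) : ℂ) ∂P =
      (if i = j then Z m m * d * ν ^ 2 else 0) + if j = m then Z i m * d * ν ^ 2 else 0 := fun m => by
    rw [integral_finsetSum _ fun n _ => (hi m n).const_mul _]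
    simp_rw [e2, Finset.sum_add_distrib, ite_and]
    congr 1
    · split_ifs <;> simp
    · simp
  simp_rw [e3, Finset.sum_add_distrib]
  simp only [Finset.sum_ite_eq, Finset.mem_univ, if_true, Matrix.smul_apply, Matrix.add_apply,
    one_apply, smul_eq_mul]
  by_cases hij : i = j
  · simp only [hij, if_true, trace, diag_apply, ← Finset.sum_mul]
    push_cast
    ring
  · simp only [hij, if_false]
    push_cast
    simp
    ring

end Isotropy

end CodedDiffraction

namespace CodedDiffraction

/-! ### The truncation threshold -/

section Truncation

open Matrix

variable {d : ℕ}

theorem truncRate_ge {b ν : ℝ} (hν : 0 < ν) (h : 2 * ν ≤ b ^ 2) : 9 ≤ truncRate b ν := by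
  have h1 : (1 : ℝ) ≤ Real.logb 2 (b ^ 2 / ν) := by
    rw [Real.le_logb_iff_rpow_le one_lt_two (by have := hν.trans_le (by linarith : ν ≤ b ^ 2); positivity),
      Real.rpow_one, le_div_iff₀ hν]
    exact h
  rw [truncRate]
  linarith

theorem one_le_log {d : ℕ} (hd : 3 ≤ d) : 1 ≤ Real.log d := by
  rw [Real.le_log_iff_exp_le (by positivity)]
  have h : (3 : ℝ) ≤ d := by exact_mod_cast hd
  linarith [Real.exp_one_lt_d9]

theorem two_rpow_three_halves : (2 : ℝ) ^ (3 / 2 : ℝ) = 2 * √2 := by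
  rw [Real.sqrt_eq_rpow, show (3 / 2 : ℝ) = 1 + 1 / 2 by norm_num, Real.rpow_add two_pos,
    Real.rpow_one]

/-- For `d ≥ 32` one has `log d ≥ 5 log 2`, and `γ log 2 = 8 log 2 + log (b²/ν)`. This explains the
exponents `40 = 5 * 8` and `5`. -/
theorem exp_neg_truncRate_mul_log_le {b ν : ℝ} (hν : 0 < ν) (h : 2 * ν ≤ b ^ 2) {d : ℕ}
    (hd : 32 ≤ d) : Real.exp (-(truncRate b ν * Real.log d)) ≤ (1 / 2) ^ 40 * (ν / b ^ 2) ^ 5 := by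
  have hb : 0 < b ^ 2 := by linarith
  have hy : 0 < b ^ 2 / ν := by positivity
  have hlog : 5 * Real.log 2 ≤ Real.log d := by
    have : Real.log 32 = 5 * Real.log 2 := by
      rw [show (32 : ℝ) = 2 ^ 5 by norm_num, Real.log_pow]; norm_num
    rw [← this]
    exact Real.log_le_log (by norm_num) (by exact_mod_cast hd)
  have hγ : truncRate b ν * Real.log 2 = 8 * Real.log 2 + Real.log (b ^ 2 / ν) := by
    rw [truncRate, add_mul, Real.logb, div_mul_cancel₀ _ (Real.log_pos one_lt_two).ne']
  have h1 : 40 * Real.log 2 + 5 * Real.log (b ^ 2 / ν) ≤ truncRate b ν * Real.log d := by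
    have := mul_le_mul_of_nonneg_left hlog (by linarith [truncRate_ge hν h] : 0 ≤ truncRate b ν)
    linarith
  refine (Real.exp_le_exp.2 (neg_le_neg h1)).trans_eq ?_
  have e : -(40 * Real.log 2 + 5 * Real.log (b ^ 2 / ν)) =
      ((40 : ℕ) : ℝ) * Real.log (1 / 2) + ((5 : ℕ) : ℝ) * Real.log (ν / b ^ 2) := by
    rw [one_div, Real.log_inv, ← inv_div (b ^ 2) ν, Real.log_inv]; push_cast; ring
  rw [e, Real.exp_add, Real.exp_nat_mul, Real.exp_nat_mul, Real.exp_log (by norm_num),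
    Real.exp_log (by positivity)]

/-- Here `18 = 2 * 9`, where 9 is the lower bound for `γ`. -/
theorem le_eighteen_mul_log {d : ℕ} (hd : 3 ≤ d) (hd' : d < 32) : (d : ℝ) ≤ 18 * Real.log d := by
  have h1 := one_le_log hd
  rcases le_or_gt d 18 with h | h
  · have : (d : ℝ) ≤ 18 := by exact_mod_cast h
    linarith
  · have h16 : Real.log 16 = 4 * Real.log 2 := by
      rw [show (16 : ℝ) = 2 ^ 4 by norm_num, Real.log_pow]; norm_num
    have h2 : Real.log 16 ≤ Real.log d :=
      Real.log_le_log (by norm_num) (by exact_mod_cast (by omega : 16 ≤ d))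
    have : (d : ℝ) ≤ 32 := by exact_mod_cast hd'.le
    linarith [Real.log_two_gt_d9]

theorem fourierCoeff_smul (a : Fin d → ℝ) (k : Fin d) (c : ℂ) (v : Fin d → ℂ) :
    fourierCoeff a k (c • v) = c * fourierCoeff a k v := by
  simp only [fourierCoeff, Finset.mul_sum, Pi.smul_apply, smul_eq_mul]
  exact Finset.sum_congr rfl fun i _ => by ring

/-- The vector `y` is the tangent vector `w` of `Z` rescaled by `√2 / ‖Z‖₂`. The trace thereby
becomes a product of two coefficients of vectors of norm at most 1, to which the tail and moment
bounds apply. -/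
theorem exists_trace_bound {x : Fin d → ℂ} (hx : ∑ i, ‖x i‖ ^ 2 = 1)
    {Z : Matrix (Fin d) (Fin d) ℂ} (hZ : Z ∈ tangentSpace x) (hZ0 : Z ≠ 0) :
    ∃ y : Fin d → ℂ, ∑ i, ‖y i‖ ^ 2 ≤ 1 ∧ ∀ (a : Fin d → ℝ) (k : Fin d),
      ‖(measMatrix a k * Z).trace‖ ≤
        √2 * frobNorm Z * (‖fourierCoeff a k x‖ * ‖fourierCoeff a k y‖) := by
  obtain ⟨w, hw, hle⟩ := exists_tangent_vector hx hZ
  have hT := frobNorm_pos hZ0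
  set T := frobNorm Z with hTdef
  have h2 : (√2) ^ 2 = 2 := Real.sq_sqrt zero_le_two
  have h20 : 0 < √2 := Real.sqrt_pos.2 two_pos
  refine ⟨((√2 / T : ℝ) : ℂ) • w, ?_, fun a k => ?_⟩
  · simp only [Pi.smul_apply, smul_eq_mul, norm_mul, mul_pow, ← Finset.mul_sum]
    rw [Complex.norm_real, Real.norm_of_nonneg (by positivity), div_pow, h2, div_mul_eq_mul_div,
      div_le_one (by positivity)]
    exact hle
  · rw [fourierCoeff_smul, norm_mul, Complex.norm_real, Real.norm_of_nonneg (by positivity), hw]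
    refine (norm_trace_measMatrix_mul_le a k x w).trans_eq ?_
    field_simp
    rw [h2]
    ring

theorem star_trace_of_mem_tangentSpace {x : Fin d → ℂ} {Z : Matrix (Fin d) (Fin d) ℂ}
    (hZ : Z ∈ tangentSpace x) (a : Fin d → ℝ) (k : Fin d) :
    star (measMatrix a k * Z).trace = (measMatrix a k * Z).trace := by
  obtain ⟨z, rfl⟩ := hZ
  exact star_trace_measMatrix_mul a k x z

open scoped Classical in
/-- The truncated coefficient `1_{U_k} tr (F_k Z)`. -/
noncomputable def truncCoeff (b ν : ℝ) (Z : Matrix (Fin d) (Fin d) ℂ) (a : Fin d → ℝ) (k : Fin d) : ℂ :=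
  if TruncEvent b ν Z a k then (measMatrix a k * Z).trace else 0

theorem truncSummand_eq (L : ℕ) (b ν : ℝ) (Z : Matrix (Fin d) (Fin d) ℂ) (a : Fin d → ℝ) :
    truncSummand L b ν Z a Z =
      (1 / (ν ^ 2 * d * L) : ℝ) • weightedMeas (truncCoeff b ν Z a) a := by
  simp only [truncSummand, weightedMeas, truncCoeff, ite_smul, zero_smul]

theorem norm_truncCoeff_le (b ν : ℝ) (Z : Matrix (Fin d) (Fin d) ℂ) (a : Fin d → ℝ) (k : Fin d) :
    ‖truncCoeff b ν Z a k‖ ≤ ‖(measMatrix a k * Z).trace‖ := by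
  unfold truncCoeff
  split_ifs
  · exact le_rfl
  · simp

/-- By Parseval each squared coefficient is at most `d b²`, which for these small `d` lies below the
threshold `2 b² γ log d`; truncation is then vacuous. -/
theorem truncEvent_of_lt {x : Fin d → ℂ} (hx : ∑ i, ‖x i‖ ^ 2 = 1)
    {Z : Matrix (Fin d) (Fin d) ℂ} (hZ : Z ∈ tangentSpace x) (hZ0 : Z ≠ 0) (hd : 3 ≤ d)
    (hd' : d < 32) {b ν : ℝ} (hν : 0 < ν) (h : 2 * ν ≤ b ^ 2) {a : Fin d → ℝ}
    (ha : ∀ i, |a i| ≤ b) (k : Fin d) : TruncEvent b ν Z a k := by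
  obtain ⟨y, hy, htr⟩ := exists_trace_bound hx hZ hZ0
  have hg : ∀ v : Fin d → ℂ, ∑ i, ‖v i‖ ^ 2 ≤ 1 → ‖fourierCoeff a k v‖ ^ 2 ≤ d * b ^ 2 := fun v hv => by
    refine (Finset.single_le_sum (f := fun k => ‖fourierCoeff a k v‖ ^ 2)
      (fun k _ => by positivity) (Finset.mem_univ k)).trans
      ((sum_norm_sq_fourierCoeff_le (by omega) ha v).trans ?_)
    exact mul_le_mul_of_nonneg_left (mul_le_of_le_one_right (sq_nonneg b) hv) (Nat.cast_nonneg d)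
  have h1 : ‖fourierCoeff a k x‖ * ‖fourierCoeff a k y‖ ≤ d * b ^ 2 := by
    nlinarith [hg x hx.le, hg y hy, sq_nonneg (‖fourierCoeff a k x‖ - ‖fourierCoeff a k y‖)]
  have h2 : (d : ℝ) ≤ 2 * (truncRate b ν * Real.log d) := by
    have := mul_le_mul_of_nonneg_right (truncRate_ge hν h) (zero_le_one.trans (one_le_log hd))
    linarith [le_eighteen_mul_log hd hd']
  have hT := frobNorm_nonneg Z
  refine (htr a k).trans ?_
  rw [two_rpow_three_halves]
  calc _ ≤ √2 * frobNorm Z * (2 * (truncRate b ν * Real.log d) * b ^ 2) := by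
        refine mul_le_mul_of_nonneg_left ?_ (by positivity)
        exact h1.trans (mul_le_mul_of_nonneg_right h2 (sq_nonneg b))
    _ = _ := by ring

/-- Of the factor `2^(3/2) = √2 * 2`, the `√2` matches the trace bound and the 2 the subgaussian
tail. If a product exceeds a level, one of the two squares does. -/
theorem lt_or_lt_of_not_truncEvent {Z : Matrix (Fin d) (Fin d) ℂ} (hZ0 : Z ≠ 0)
    {x y : Fin d → ℂ} {b ν : ℝ} {a : Fin d → ℝ} {k : Fin d}
    (htr : ‖(measMatrix a k * Z).trace‖ ≤
      √2 * frobNorm Z * (‖fourierCoeff a k x‖ * ‖fourierCoeff a k y‖))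
    (h : ¬ TruncEvent b ν Z a k) :
    2 * b ^ 2 * (truncRate b ν * Real.log d) < ‖fourierCoeff a k x‖ ^ 2 ∨
      2 * b ^ 2 * (truncRate b ν * Real.log d) < ‖fourierCoeff a k y‖ ^ 2 := by
  rw [TruncEvent, not_le, two_rpow_three_halves] at h
  have hT := frobNorm_pos hZ0
  have h20 : 0 < √2 := Real.sqrt_pos.2 two_pos
  have h1 : √2 * frobNorm Z * (2 * b ^ 2 * (truncRate b ν * Real.log d)) <
      √2 * frobNorm Z * (‖fourierCoeff a k x‖ * ‖fourierCoeff a k y‖) := by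
    refine lt_of_eq_of_lt ?_ (h.trans_le htr)
    ring
  have h2 := lt_of_mul_lt_mul_left h1 (by positivity)
  by_contra! hcon
  nlinarith [hcon.1, hcon.2, sq_nonneg (‖fourierCoeff a k x‖ - ‖fourierCoeff a k y‖)]

theorem four_mul_le (p q r s : ℝ) :
    p ^ 2 * q ^ 2 * (r ^ 2 * s ^ 2) ≤ (p ^ 8 + q ^ 8 + (r ^ 8 + s ^ 8)) / 4 := by
  nlinarith [sq_nonneg (p ^ 2 * q ^ 2 - r ^ 2 * s ^ 2), sq_nonneg (p ^ 4 - q ^ 4),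
    sq_nonneg (r ^ 4 - s ^ 4)]

end Truncation

/-! ### Truncation error and second moment of one measurement -/

section PatternMoments

open Matrix

variable {d : ℕ} {Ω : Type*} [MeasurableSpace Ω] {P : Measure Ω} {b ν : ℝ} {a : Fin d → Ω → ℝ}
theorem IsPattern.measurableSet_truncEvent (h : IsPattern P b ν a) (k : Fin d)
    (Z : Matrix (Fin d) (Fin d) ℂ) :
    MeasurableSet {ω | TruncEvent b ν Z (fun i => a i ω) k} :=
  measurableSet_le (h.measurable_trace k Z).norm measurable_const

theorem IsPattern.measurable_truncCoeff (h : IsPattern P b ν a) (k : Fin d)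
    (Z : Matrix (Fin d) (Fin d) ℂ) :
    Measurable fun ω => truncCoeff b ν Z (fun i => a i ω) k := by
  classical
  unfold truncCoeff
  exact Measurable.ite (h.measurableSet_truncEvent k Z) (h.measurable_trace k Z) measurable_const

variable [IsProbabilityMeasure P]

/-- Compare `E ε⁴ = 2ν²` with `b² E ε² = b² ν`. This is what gives `γ ≥ 9`. -/
theorem IsPattern.two_mul_le (h : IsPattern P b ν a) (hν : 0 < ν) (i : Fin d) : 2 * ν ≤ b ^ 2 := by
  have hm := h.measurable
  have hsq : ∀ ω, a i ω ^ 2 ≤ b ^ 2 := fun ω => by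
    rw [← sq_abs]; exact pow_le_pow_left₀ (abs_nonneg _) (h.abs_le i ω) 2
  have hint : Integrable (fun ω => a i ω ^ 2) P :=
    Integrable.of_bound (by fun_prop) (b ^ 2) (Filter.Eventually.of_forall fun ω => by
      rw [Real.norm_of_nonneg (sq_nonneg _)]; exact hsq ω)
  have h1 : ∫ ω, a i ω ^ 4 ∂P ≤ ∫ ω, b ^ 2 * a i ω ^ 2 ∂P := by
    refine integral_mono_of_nonneg (Filter.Eventually.of_forall fun ω => by positivity)
      (hint.const_mul _) (Filter.Eventually.of_forall fun ω => ?_)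
    nlinarith [hsq ω, sq_nonneg (a i ω)]
  rw [integral_const_mul, h.second, h.fourth] at h1
  nlinarith

theorem IsPattern.integrable_norm_pow (h : IsPattern P b ν a) (k : Fin d) (v : Fin d → ℂ) (m : ℕ) :
    Integrable (fun ω => ‖fourierCoeff (fun i => a i ω) k v‖ ^ m) P := by
  have := h.measurable_fourierCoeff k v
  refine Integrable.of_bound (this.norm.pow_const m).aestronglyMeasurable ((b * ∑ i, ‖v i‖) ^ m)
    (Filter.Eventually.of_forall fun ω => ?_)
  rw [norm_pow, norm_norm]
  exact pow_le_pow_left₀ (norm_nonneg _) (norm_fourierCoeff_le (fun i => h.abs_le i ω) k v) m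

theorem IsPattern.integral_sum_pow_eight_le (h : IsPattern P b ν a) (hb : 0 < b) (k : Fin d)
    {x y u v : Fin d → ℂ} (hx : ∑ i, ‖x i‖ ^ 2 ≤ 1) (hy : ∑ i, ‖y i‖ ^ 2 ≤ 1)
    (hu : ∑ i, ‖u i‖ ^ 2 ≤ 1) (hv : ∑ i, ‖v i‖ ^ 2 ≤ 1) :
    Integrable (fun ω => ‖fourierCoeff (fun i => a i ω) k x‖ ^ 8 +
        ‖fourierCoeff (fun i => a i ω) k y‖ ^ 8 + (‖fourierCoeff (fun i => a i ω) k u‖ ^ 8 +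
        ‖fourierCoeff (fun i => a i ω) k v‖ ^ 8)) P ∧
      ∫ ω, (‖fourierCoeff (fun i => a i ω) k x‖ ^ 8 +
        ‖fourierCoeff (fun i => a i ω) k y‖ ^ 8 + (‖fourierCoeff (fun i => a i ω) k u‖ ^ 8 +
        ‖fourierCoeff (fun i => a i ω) k v‖ ^ 8)) ∂P ≤ 4 * (2580480 * b ^ 8) := by
  have i1 : Integrable (fun ω => ‖fourierCoeff (fun i => a i ω) k x‖ ^ 8 +
      ‖fourierCoeff (fun i => a i ω) k y‖ ^ 8) P :=
    (h.integrable_norm_pow k x 8).add (h.integrable_norm_pow k y 8)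
  have i2 : Integrable (fun ω => ‖fourierCoeff (fun i => a i ω) k u‖ ^ 8 +
      ‖fourierCoeff (fun i => a i ω) k v‖ ^ 8) P :=
    (h.integrable_norm_pow k u 8).add (h.integrable_norm_pow k v 8)
  refine ⟨i1.add i2, ?_⟩
  rw [integral_add i1 i2, integral_add (h.integrable_norm_pow k x 8) (h.integrable_norm_pow k y 8),
    integral_add (h.integrable_norm_pow k u 8) (h.integrable_norm_pow k v 8)]
  linarith [h.integral_norm_pow_eight_le hb k hx, h.integral_norm_pow_eight_le hb k hy,
    h.integral_norm_pow_eight_le hb k hu, h.integral_norm_pow_eight_le hb k hv]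

variable {x : Fin d → ℂ} {Z : Matrix (Fin d) (Fin d) ℂ}

theorem IsPattern.measureReal_not_truncEvent_le (h : IsPattern P b ν a) (hb : 0 < b) (hν : 0 < ν)
    (hx : ∑ i, ‖x i‖ ^ 2 = 1) (hZ : Z ∈ tangentSpace x) (hZ0 : Z ≠ 0) (hd : 32 ≤ d) (k : Fin d) :
    P.real {ω | ¬ TruncEvent b ν Z (fun i => a i ω) k} ≤ 8 * ((1 / 2) ^ 40 * (ν / b ^ 2) ^ 5) := by
  obtain ⟨y, hy, htr⟩ := exists_trace_bound hx hZ hZ0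
  have h2ν := h.two_mul_le hν k
  have hu : 0 ≤ truncRate b ν * Real.log d :=
    mul_nonneg (by linarith [truncRate_ge hν h2ν]) (by linarith [one_le_log (by omega : 3 ≤ d)])
  have h1 := h.measureReal_lt_norm_sq_le hb k hx.le hu
  have h2 := h.measureReal_lt_norm_sq_le hb k hy hu
  have h3 := exp_neg_truncRate_mul_log_le hν h2ν hd
  refine (measureReal_mono fun ω hω => ?_).trans ((measureReal_union_le _ _).trans
    ((add_le_add h1 h2).trans (by linarith)))
  exact lt_or_lt_of_not_truncEvent hZ0 (htr _ k) hω

/-- The truncation error of a single measurement. -/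
theorem IsPattern.integral_truncation_error_le (h : IsPattern P b ν a) (hb : 0 < b) (hν : 0 < ν)
    (hx : ∑ i, ‖x i‖ ^ 2 = 1) (hZ : Z ∈ tangentSpace x) (hZ0 : Z ≠ 0) (hd : 3 ≤ d) (k : Fin d)
    {u v : Fin d → ℂ} (hu : ∑ i, ‖u i‖ ^ 2 ≤ 1) (hv : ∑ i, ‖v i‖ ^ 2 ≤ 1) :
    ∫ ω, ‖(measMatrix (fun i => a i ω) k * Z).trace - truncCoeff b ν Z (fun i => a i ω) k‖ *
      (‖fourierCoeff (fun i => a i ω) k u‖ * ‖fourierCoeff (fun i => a i ω) k v‖) ∂P ≤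
      ν ^ 2 * frobNorm Z / 16 := by
  have h2ν := h.two_mul_le hν k
  have hT := frobNorm_pos hZ0
  rcases lt_or_ge d 32 with hd' | hd'
  · have h0 : ∀ ω, (measMatrix (fun i => a i ω) k * Z).trace -
        truncCoeff b ν Z (fun i => a i ω) k = 0 := fun ω => by
      rw [truncCoeff, if_pos (truncEvent_of_lt hx hZ hZ0 hd hd' hν h2ν (fun i => h.abs_le i ω) k),
        sub_self]
    simp only [h0, norm_zero, zero_mul, integral_zero]
    positivity
  obtain ⟨y, hy, htr⟩ := exists_trace_bound hx hZ hZ0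
  obtain ⟨hi, hI⟩ := h.integral_sum_pow_eight_le hb k hx.le hy hu hv
  set T := frobNorm Z with hTdef
  -- Weight in `W ≤ λ/2 + W²/(2λ)`, which replaces Hölder: the quadratic part is bounded by eighth
  -- moments and, for this `λ`, costs exactly `ν² T / 32`.
  set lam : ℝ := 32 * 2580480 * b ^ 8 * T / ν ^ 2 with hlam
  have hlam0 : 0 < lam := by positivity
  have hms := (h.measurableSet_truncEvent k Z).compl
  set U : Set Ω := {ω | TruncEvent b ν Z (fun i => a i ω) k}ᶜ with hU
  have hindint : Integrable (U.indicator fun _ => lam / 2) P :=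
    (integrable_const _).indicator hms
  have hpt : ∀ ω, ‖(measMatrix (fun i => a i ω) k * Z).trace -
      truncCoeff b ν Z (fun i => a i ω) k‖ *
      (‖fourierCoeff (fun i => a i ω) k u‖ * ‖fourierCoeff (fun i => a i ω) k v‖) ≤
      U.indicator (fun _ => lam / 2) ω + T ^ 2 / (4 * lam) *
        (‖fourierCoeff (fun i => a i ω) k x‖ ^ 8 +
        ‖fourierCoeff (fun i => a i ω) k y‖ ^ 8 + (‖fourierCoeff (fun i => a i ω) k u‖ ^ 8 +
        ‖fourierCoeff (fun i => a i ω) k v‖ ^ 8)) := by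
    intro ω
    by_cases hω : TruncEvent b ν Z (fun i => a i ω) k
    · rw [truncCoeff, if_pos hω, sub_self, norm_zero, zero_mul]
      have : 0 ≤ U.indicator (fun _ => lam / 2) ω :=
        Set.indicator_nonneg (fun _ _ => by positivity) ω
      positivity
    · rw [truncCoeff, if_neg hω, sub_zero, Set.indicator_of_mem (show ω ∈ U from hω)]
      have h1 := htr (fun i => a i ω) k
      set p := ‖fourierCoeff (fun i => a i ω) k x‖
      set q := ‖fourierCoeff (fun i => a i ω) k y‖
      set r := ‖fourierCoeff (fun i => a i ω) k u‖
      set s := ‖fourierCoeff (fun i => a i ω) k v‖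
      have hr : 0 ≤ r := norm_nonneg _
      have hs : 0 ≤ s := norm_nonneg _
      set W := √2 * T * (p * q) * (r * s) with hW
      have hW2 : W ^ 2 = 2 * T ^ 2 * (p ^ 2 * q ^ 2 * (r ^ 2 * s ^ 2)) := by
        rw [hW, mul_pow, mul_pow, mul_pow, Real.sq_sqrt zero_le_two]; ring
      have h3 : W ≤ lam / 2 + W ^ 2 / (2 * lam) := by
        rw [div_add_div _ _ two_ne_zero (by positivity), le_div_iff₀ (by positivity)]
        nlinarith [sq_nonneg (W - lam)]
      calc _ ≤ W := mul_le_mul_of_nonneg_right h1 (by positivity)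
        _ ≤ lam / 2 + W ^ 2 / (2 * lam) := h3
        _ ≤ _ := by
          have e : T ^ 2 / (4 * lam) * (p ^ 8 + q ^ 8 + (r ^ 8 + s ^ 8)) =
              2 * T ^ 2 * ((p ^ 8 + q ^ 8 + (r ^ 8 + s ^ 8)) / 4) / (2 * lam) := by
            field_simp
          rw [e, hW2]
          gcongr
          exact four_mul_le p q r s
  refine (integral_mono_of_nonneg (Filter.Eventually.of_forall fun ω => by positivity)
    (hindint.add (hi.const_mul _)) (Filter.Eventually.of_forall hpt)).trans ?_
  have hPU := h.measureReal_not_truncEvent_le hb hν hx hZ hZ0 hd' k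
  change P.real U ≤ _ at hPU
  have e := integral_add hindint (hi.const_mul (T ^ 2 / (4 * lam)))
  simp only [Pi.add_apply] at e ⊢
  rw [e, integral_indicator_const _ hms, integral_const_mul, smul_eq_mul]
  have hb2 : 0 < b ^ 2 := by positivity
  -- Four of the five factors `ν / b²` in the tail absorb the `b⁸` in `λ`; the fifth is at most 1.
  have c1 : P.real U * (lam / 2) ≤ ν ^ 2 * T / 32 := by
    have hq : ν / b ^ 2 ≤ 1 := (div_le_one hb2).2 (by linarith)
    calc P.real U * (lam / 2) ≤ 8 * ((1 / 2) ^ 40 * (ν / b ^ 2) ^ 5) * (lam / 2) := by gcongr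
      _ = (128 * 2580480 / 2 ^ 40) * (ν ^ 2 * T) * (ν / b ^ 2) := by
        rw [hlam]; field_simp; norm_num
      _ ≤ (128 * 2580480 / 2 ^ 40) * (ν ^ 2 * T) * 1 := by gcongr
      _ ≤ _ := by
        have : 0 < ν ^ 2 * T := by positivity
        norm_num
        linarith
  have c2 : T ^ 2 / (4 * lam) * (4 * (2580480 * b ^ 8)) = ν ^ 2 * T / 32 := by
    rw [hlam]; field_simp
  have c3 := mul_le_mul_of_nonneg_left hI (by positivity : 0 ≤ T ^ 2 / (4 * lam))
  linarith

/-- The second moment of a single truncated measurement. -/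
theorem IsPattern.integral_truncCoeff_sq_le (h : IsPattern P b ν a) (hb : 0 < b)
    (hx : ∑ i, ‖x i‖ ^ 2 = 1) (hZ : Z ∈ tangentSpace x) (hZ0 : Z ≠ 0) (k : Fin d)
    (u : Fin d → ℂ) :
    ∫ ω, ‖truncCoeff b ν Z (fun i => a i ω) k‖ ^ 2 * ‖fourierCoeff (fun i => a i ω) k u‖ ^ 2 ∂P ≤
      2 * 2580480 * frobNorm Z ^ 2 * b ^ 6 * ∑ i, ‖u i‖ ^ 2 := by
  obtain ⟨y, hy, htr⟩ := exists_trace_bound hx hZ hZ0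
  set T := frobNorm Z with hTdef
  have hT : 0 < T := frobNorm_pos hZ0
  have hunit : ∀ v : Fin d → ℂ, ∑ i, ‖v i‖ ^ 2 ≤ 1 →
      ∫ ω, ‖truncCoeff b ν Z (fun i => a i ω) k‖ ^ 2 * ‖fourierCoeff (fun i => a i ω) k v‖ ^ 2 ∂P ≤
      2 * 2580480 * T ^ 2 * b ^ 6 := by
    intro v hv
    have hb2 : 0 < b ^ 2 := by positivity
    have i3 : Integrable (fun ω => ‖fourierCoeff (fun i => a i ω) k x‖ ^ 8 +
        ‖fourierCoeff (fun i => a i ω) k y‖ ^ 8 + ‖fourierCoeff (fun i => a i ω) k v‖ ^ 8) P :=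
      ((h.integrable_norm_pow k x 8).add (h.integrable_norm_pow k y 8)).add
        (h.integrable_norm_pow k v 8)
    have i4 : Integrable (fun ω => 2 * T ^ 2 / (4 * b ^ 2) * (‖fourierCoeff (fun i => a i ω) k x‖ ^ 8 +
        ‖fourierCoeff (fun i => a i ω) k y‖ ^ 8 + ‖fourierCoeff (fun i => a i ω) k v‖ ^ 8 + b ^ 8)) P :=
      (i3.add (integrable_const _)).const_mul _
    refine (integral_mono_of_nonneg (Filter.Eventually.of_forall fun ω => by positivity) i4
      (Filter.Eventually.of_forall fun ω => ?_)).trans ?_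
    · have h1 := (norm_truncCoeff_le b ν Z (fun i => a i ω) k).trans (htr (fun i => a i ω) k)
      set p := ‖fourierCoeff (fun i => a i ω) k x‖
      set q := ‖fourierCoeff (fun i => a i ω) k y‖
      set r := ‖fourierCoeff (fun i => a i ω) k v‖
      have h2 := pow_le_pow_left₀ (norm_nonneg _) h1 2
      have h3 : (√2 * T * (p * q)) ^ 2 = 2 * T ^ 2 * (p ^ 2 * q ^ 2) := by
        rw [mul_pow, mul_pow, mul_pow, Real.sq_sqrt zero_le_two]
      rw [h3] at h2
      -- Only three squared coefficients occur; `b²` serves as the fourth factor so that the eighth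
      -- moment bound can be reused.
      have h4 := four_mul_le p q r b
      calc _ ≤ 2 * T ^ 2 * (p ^ 2 * q ^ 2) * r ^ 2 := mul_le_mul_of_nonneg_right h2 (sq_nonneg r)
        _ = 2 * T ^ 2 / b ^ 2 * (p ^ 2 * q ^ 2 * (r ^ 2 * b ^ 2)) := by field_simp
        _ ≤ 2 * T ^ 2 / b ^ 2 * ((p ^ 8 + q ^ 8 + (r ^ 8 + b ^ 8)) / 4) := by gcongr
        _ = _ := by field_simp; ring
    · rw [integral_const_mul]
      have e1 := integral_add i3 (integrable_const (μ := P) (b ^ 8))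
      have i5 : Integrable (fun ω => ‖fourierCoeff (fun i => a i ω) k x‖ ^ 8 +
        ‖fourierCoeff (fun i => a i ω) k y‖ ^ 8) P :=
        (h.integrable_norm_pow k x 8).add (h.integrable_norm_pow k y 8)
      rw [e1, integral_add i5 (h.integrable_norm_pow k v 8),
        integral_add (h.integrable_norm_pow k x 8) (h.integrable_norm_pow k y 8)]
      have t1 := h.integral_norm_pow_eight_le hb k hx.le
      have t2 := h.integral_norm_pow_eight_le hb k hy
      have t3 := h.integral_norm_pow_eight_le hb k hv
      have hb8 : 0 < b ^ 8 := by positivity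
      calc _ ≤ 2 * T ^ 2 / (4 * b ^ 2) * (4 * (2580480 * b ^ 8)) := by
            gcongr
            simp only [integral_const, probReal_univ, one_smul]
            linarith
        _ = _ := by field_simp
  by_cases hu : u = 0
  · subst hu
    simp [fourierCoeff]
  obtain ⟨i, hi⟩ := Function.ne_iff.1 hu
  have hS : 0 < ∑ i, ‖u i‖ ^ 2 := Finset.sum_pos' (fun j _ => by positivity)
      ⟨i, Finset.mem_univ i, pow_pos (norm_pos_iff.2 hi) 2⟩
  set S := ∑ i, ‖u i‖ ^ 2 with hSdef
  have hs2 : ‖(((√S)⁻¹ : ℝ) : ℂ)‖ ^ 2 = S⁻¹ := by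
    rw [Complex.norm_real, norm_inv, inv_pow, Real.norm_of_nonneg (Real.sqrt_nonneg _),
      Real.sq_sqrt hS.le]
  have h1 := hunit ((((√S)⁻¹ : ℝ) : ℂ) • u) (by
    simp only [Pi.smul_apply, smul_eq_mul, norm_mul, mul_pow, ← Finset.mul_sum, hs2, ← hSdef]
    exact (inv_mul_cancel₀ hS.ne').le)
  simp only [fourierCoeff_smul, norm_mul, mul_pow, hs2] at h1
  have e : ∀ ω, ‖truncCoeff b ν Z (fun i => a i ω) k‖ ^ 2 *
      (S⁻¹ * ‖fourierCoeff (fun i => a i ω) k u‖ ^ 2) = S⁻¹ *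
      (‖truncCoeff b ν Z (fun i => a i ω) k‖ ^ 2 * ‖fourierCoeff (fun i => a i ω) k u‖ ^ 2) :=
    fun ω => by ring
  simp_rw [e] at h1
  rw [integral_const_mul, inv_mul_le_iff₀ hS] at h1
  linarith

end PatternMoments

end CodedDiffraction

namespace CodedDiffraction

/-! ### Norm, variance and mean of the truncated summands -/

section Final

open Matrix
open scoped Matrix.Norms.L2Operator

variable {d : ℕ}

theorem outer_mul_self {x : Fin d → ℂ} (hx : ∑ i, ‖x i‖ ^ 2 = 1) :
    outer x x * outer x x = outer x x := by
  rw [outer, vecMulVec_mul_vecMulVec, star_dotProduct_self_eq_sum, hx]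
  simp

/-- This factored form shows both that the map is a contraction and that it annihilates the tangent
space. -/
theorem projTPerp_eq (x : Fin d → ℂ) (W : Matrix (Fin d) (Fin d) ℂ) :
    projTPerp x W = (1 - outer x x) * W * (1 - outer x x) := by
  rw [projTPerp, projT]
  noncomm_ring

theorem norm_one_sub_outer_le {x : Fin d → ℂ} (hx : ∑ i, ‖x i‖ ^ 2 = 1) :
    ‖1 - outer x x‖ ≤ 1 := by
  have hh : (1 - outer x x)ᴴ = 1 - outer x x := by
    rw [conjTranspose_sub, conjTranspose_one, outer, conjTranspose_vecMulVec, star_star]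
  have hsq : (1 - outer x x) * (1 - outer x x) = 1 - outer x x := by
    have := outer_mul_self hx
    rw [mul_sub, mul_one, sub_mul, one_mul, this, sub_self, sub_zero]
  have h := l2_opNorm_conjTranspose_mul_self (1 - outer x x)
  rw [hh, hsq] at h
  nlinarith [norm_nonneg (1 - outer x x)]

theorem norm_projTPerp_le {x : Fin d → ℂ} (hx : ∑ i, ‖x i‖ ^ 2 = 1)
    (W : Matrix (Fin d) (Fin d) ℂ) : ‖projTPerp x W‖ ≤ ‖W‖ := by
  have h := norm_one_sub_outer_le hx
  rw [projTPerp_eq]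
  calc _ ≤ ‖1 - outer x x‖ * ‖W‖ * ‖1 - outer x x‖ :=
        (norm_mul_le _ _).trans (mul_le_mul_of_nonneg_right (norm_mul_le _ _) (norm_nonneg _))
    _ ≤ 1 * ‖W‖ * 1 := by gcongr
    _ = ‖W‖ := by ring

theorem projTPerp_add (x : Fin d → ℂ) (W W' : Matrix (Fin d) (Fin d) ℂ) :
    projTPerp x (W + W') = projTPerp x W + projTPerp x W' := by
  simp only [projTPerp_eq, mul_add, add_mul]

theorem projTPerp_of_mem_tangentSpace {x : Fin d → ℂ} (hx : ∑ i, ‖x i‖ ^ 2 = 1)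
    {Z : Matrix (Fin d) (Fin d) ℂ} (hZ : Z ∈ tangentSpace x) : projTPerp x Z = 0 := by
  obtain ⟨z, rfl⟩ := hZ
  have hxx : star x ⬝ᵥ x = 1 := by rw [star_dotProduct_self_eq_sum, hx, Complex.ofReal_one]
  have h1 : (1 - outer x x) * outer x z = 0 := by
    rw [sub_mul, one_mul, outer, outer, vecMulVec_mul_vecMulVec, hxx]
    simp
  have h2 : outer z x * (1 - outer x x) = 0 := by
    rw [mul_sub, mul_one, outer, outer, vecMulVec_mul_vecMulVec, hxx]
    simp
  rw [projTPerp_eq, mul_add, add_mul, h1, mul_assoc _ (outer z x), h2]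
  simp

variable {Ω : Type*} [MeasurableSpace Ω] {P : Measure Ω} [IsProbabilityMeasure P] {b ν : ℝ}

/-- The rows of an independent array are independent. -/
theorem iIndepFun_rows {ι κ : Type*} {X : ι → κ → Ω → ℝ} (hm : ∀ i j, Measurable (X i j))
    (h : iIndepFun (fun p : ι × κ => X p.1 p.2) P) :
    iIndepFun (fun i ω j => X i j ω) P := by
  have hp : ∀ i j, IsProbabilityMeasure (P.map (X i j)) := fun i j =>
    Measure.isProbabilityMeasure_map (hm i j).aemeasurable
  have hrow : ∀ i, iIndepFun (X i) P := fun i =>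
    h.precomp (g := fun j => (i, j)) fun _ _ hjk => (Prod.mk.inj hjk).2
  rw [iIndepFun_iff_map_fun_eq_infinitePi_map (by fun_prop)]
  have h1 : P.map (fun ω (p : ι × κ) => X p.1 p.2 ω) =
      Measure.infinitePi fun p : ι × κ => P.map (X p.1 p.2) :=
    h.map_fun_eq_infinitePi_map fun p => hm p.1 p.2
  -- Currying turns the product law over pairs into the product over rows of the row laws.
  have h2 := congrArg (Measure.map (MeasurableEquiv.curry ι κ ℝ)) h1
  rw [Measure.infinitePi_map_curry fun i j => P.map (X i j),
    Measure.map_map (by fun_prop) (by fun_prop)] at h2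
  refine h2.trans ?_
  congr 1
  ext1 i
  exact ((hrow i).map_fun_eq_infinitePi_map (hm i)).symm

variable {x : Fin d → ℂ} {Z : Matrix (Fin d) (Fin d) ℂ} {a : Fin d → Ω → ℝ}

theorem norm_truncCoeff_le_threshold (hb : 0 < b) (hγ : 0 ≤ truncRate b ν) (hd : 3 ≤ d)
    (m : Fin d → ℝ) (k : Fin d) :
    ‖truncCoeff b ν Z m k‖ ≤ 3 * b ^ 2 * (truncRate b ν * Real.log d) * frobNorm Z := by
  have hT := frobNorm_nonneg Z
  have hl := one_le_log hd
  unfold truncCoeff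
  split_ifs with h
  · rw [TruncEvent, two_rpow_three_halves] at h
    have h2 : 2 * √2 ≤ 3 := by
      nlinarith [Real.sq_sqrt (zero_le_two : (0 : ℝ) ≤ 2), Real.sqrt_nonneg 2]
    calc _ ≤ 2 * √2 * b ^ 2 * truncRate b ν * Real.log d * frobNorm Z := h
      _ ≤ 3 * b ^ 2 * truncRate b ν * Real.log d * frobNorm Z := by gcongr
      _ = _ := by ring
  · rw [norm_zero]; positivity

theorem norm_truncSummand_le (hb : 0 < b) (hν : 0 < ν) (hγ : 0 ≤ truncRate b ν) (hd : 3 ≤ d)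
    {L : ℕ} (hL : 1 ≤ L) {m : Fin d → ℝ} (hm : ∀ i, |m i| ≤ b) :
    ‖truncSummand L b ν Z m Z‖ ≤
      3 * b ^ 4 * (truncRate b ν * Real.log d) * frobNorm Z / (ν ^ 2 * L) := by
  have hT := frobNorm_nonneg Z
  have hl := one_le_log hd
  have hd0 : (0 : ℝ) < d := by positivity
  have hL0 : (0 : ℝ) < L := by positivity
  have h := norm_weightedMeas_le (by omega) (by positivity) hm
    (norm_truncCoeff_le_threshold (ν := ν) (Z := Z) hb hγ hd m)
  rw [truncSummand_eq, norm_smul, Real.norm_of_nonneg (by positivity)]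
  refine (mul_le_mul_of_nonneg_left h (by positivity)).trans_eq ?_
  field_simp

theorem truncSummand_isHermitian (hZ : Z ∈ tangentSpace x) (L : ℕ) (m : Fin d → ℝ) :
    (truncSummand L b ν Z m Z).IsHermitian := by
  rw [truncSummand_eq]
  have h : (weightedMeas (truncCoeff b ν Z m) m).IsHermitian :=
    weightedMeas_isHermitian (fun k => by
      unfold truncCoeff
      split_ifs
      · exact star_trace_of_mem_tangentSpace hZ m k
      · exact star_zero _) m
  unfold Matrix.IsHermitian
  rw [conjTranspose_smul, h.eq]
  simp

theorem measurable_truncSummand (L : ℕ) (b ν : ℝ) (Z : Matrix (Fin d) (Fin d) ℂ) :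
    Measurable fun m : Fin d → ℝ => truncSummand L b ν Z m Z := by
  classical
  have htr : ∀ k, Measurable fun m : Fin d → ℝ => (measMatrix m k * Z).trace := fun k => by
    simp only [trace, diag_apply, mul_apply, measMatrix_apply]
    fun_prop
  have hc : ∀ k, Measurable fun m : Fin d → ℝ => truncCoeff b ν Z m k := fun k =>
    Measurable.ite (measurableSet_le (htr k).norm measurable_const) (htr k) measurable_const
  simp only [truncSummand_eq]
  suffices Measurable fun m : Fin d → ℝ => weightedMeas (truncCoeff b ν Z m) m from
    this.const_smul (1 / (ν ^ 2 * d * L) : ℝ)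
  refine measurable_pi_iff.2 fun i => measurable_pi_iff.2 fun j => ?_
  simp only [weightedMeas, Matrix.sum_apply, Matrix.smul_apply, measMatrix_apply, smul_eq_mul]
  fun_prop

/-- Truncation supplies only integrability here. The size comes from moments of the untruncated
trace, so no factor `γ log d` enters the variance. -/
theorem IsPattern.integral_truncSummand_mulVec_le (h : IsPattern P b ν a) (hb : 0 < b)
    (hν : 0 < ν) (hx : ∑ i, ‖x i‖ ^ 2 = 1) (hZ : Z ∈ tangentSpace x) (hZ0 : Z ≠ 0) (hd : 3 ≤ d)
    {L : ℕ} (hL : 1 ≤ L) (u : Fin d → ℂ) :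
    ∫ ω, ∑ i, ‖(truncSummand L b ν Z (fun i => a i ω) Z *ᵥ u) i‖ ^ 2 ∂P ≤
      2 * 2580480 * b ^ 8 * frobNorm Z ^ 2 / (ν ^ 4 * L ^ 2) * ∑ i, ‖u i‖ ^ 2 := by
  have hd0 : (0 : ℝ) < d := by positivity
  have hL0 : (0 : ℝ) < L := by positivity
  have hT := frobNorm_nonneg Z
  have hγ : 0 ≤ truncRate b ν := by
    linarith [truncRate_ge hν (h.two_mul_le hν ⟨0, by omega⟩)]
  have hl := one_le_log hd
  have hint : ∀ k, Integrable (fun ω => ‖truncCoeff b ν Z (fun i => a i ω) k‖ ^ 2 *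
      ‖fourierCoeff (fun i => a i ω) k u‖ ^ 2) P := fun k => by
    refine Integrable.bdd_mul (c := (3 * b ^ 2 * (truncRate b ν * Real.log d) * frobNorm Z) ^ 2)
      (h.integrable_norm_pow k u 2)
      ((h.measurable_truncCoeff k Z).norm.pow_const 2).aestronglyMeasurable
      (Filter.Eventually.of_forall fun ω => ?_)
    rw [norm_pow, norm_norm]
    exact pow_le_pow_left₀ (norm_nonneg _) (norm_truncCoeff_le_threshold hb hγ hd _ k) 2
  set κ : ℝ := 1 / (ν ^ 2 * d * L) with hκ
  have hpt : ∀ ω, ∑ i, ‖(truncSummand L b ν Z (fun i => a i ω) Z *ᵥ u) i‖ ^ 2 ≤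
      κ ^ 2 * (b ^ 2 * d) * ∑ k, ‖truncCoeff b ν Z (fun i => a i ω) k‖ ^ 2 *
        ‖fourierCoeff (fun i => a i ω) k u‖ ^ 2 := fun ω => by
    have h1 := sum_norm_sq_weightedMeas_mulVec_le (by omega) (fun i => h.abs_le i ω)
      (truncCoeff b ν Z (fun i => a i ω)) u
    rw [truncSummand_eq, smul_mulVec]
    simp only [Pi.smul_apply, norm_smul, mul_pow, ← Finset.mul_sum]
    rw [Real.norm_of_nonneg (by positivity), ← hκ]
    calc _ ≤ _ := mul_le_mul_of_nonneg_left h1 (sq_nonneg κ)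
      _ = _ := by ring
  refine (integral_mono_of_nonneg (Filter.Eventually.of_forall fun ω => by positivity)
    ((integrable_finsetSum _ fun k _ => hint k).const_mul _)
    (Filter.Eventually.of_forall hpt)).trans ?_
  rw [integral_const_mul, integral_finsetSum _ fun k _ => hint k]
  calc _ ≤ κ ^ 2 * (b ^ 2 * d) *
        ∑ _k : Fin d, 2 * 2580480 * frobNorm Z ^ 2 * b ^ 6 * ∑ i, ‖u i‖ ^ 2 := by
        gcongr with k
        exact h.integral_truncCoeff_sq_le hb hx hZ hZ0 k u
    _ = _ := by
        rw [Finset.sum_const, Finset.card_univ, Fintype.card_fin, nsmul_eq_mul, hκ]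
        field_simp

/-- The expectation of a truncated summand, up to the truncation bias. -/
theorem IsPattern.norm_integral_truncSummand_sub_le (h : IsPattern P b ν a) (hb : 0 < b)
    (hν : 0 < ν) (hx : ∑ i, ‖x i‖ ^ 2 = 1) (hZ : Z ∈ tangentSpace x) (hZ0 : Z ≠ 0) (hd : 3 ≤ d)
    (hodd : Odd d) {L : ℕ} (hL : 1 ≤ L) :
    ‖(∫ ω, truncSummand L b ν Z (fun i => a i ω) Z ∂P) -
      (1 / L : ℝ) • (Z + Z.trace • (1 : Matrix (Fin d) (Fin d) ℂ))‖ ≤ frobNorm Z / 16 / L := by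
  have hd0 : (0 : ℝ) < d := by positivity
  have hL0 : (0 : ℝ) < L := by positivity
  have hT := frobNorm_nonneg Z
  obtain ⟨y, hy, htr⟩ := exists_trace_bound hx hZ hZ0
  set D : ℝ := √2 * frobNorm Z * ((b * ∑ i, ‖x i‖) * (b * ∑ i, ‖y i‖)) with hD
  have hD0 : 0 ≤ D := by positivity
  have htrD : ∀ ω k, ‖(measMatrix (fun i => a i ω) k * Z).trace‖ ≤ D := fun ω k => by
    refine (htr _ k).trans ?_
    rw [hD]
    gcongr
    · exact norm_fourierCoeff_le (fun i => h.abs_le i ω) k x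
    · exact norm_fourierCoeff_le (fun i => h.abs_le i ω) k y
  have hint : ∀ c : Ω → Fin d → ℂ, (∀ k, Measurable fun ω => c ω k) → (∀ ω k, ‖c ω k‖ ≤ 2 * D) →
      Integrable (fun ω => weightedMeas (c ω) fun i => a i ω) P := fun c hc hcD =>
    Integrable.of_bound (h.measurable_weightedMeas hc).aestronglyMeasurable (d * b ^ 2 * (2 * D))
      (Filter.Eventually.of_forall fun ω =>
        norm_weightedMeas_le (by omega) (by positivity) (fun i => h.abs_le i ω) (hcD ω))
  have i1 := hint (fun ω k => (measMatrix (fun i => a i ω) k * Z).trace)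
    (fun k => h.measurable_trace k Z) (fun ω k => (htrD ω k).trans (by linarith))
  have i2 := hint (fun ω => truncCoeff b ν Z fun i => a i ω)
    (fun k => h.measurable_truncCoeff k Z)
    (fun ω k => (norm_truncCoeff_le _ _ _ _ _).trans ((htrD ω k).trans (by linarith)))
  set e : Ω → Fin d → ℂ := fun ω k => (measMatrix (fun i => a i ω) k * Z).trace -
    truncCoeff b ν Z (fun i => a i ω) k with he
  have heD : ∀ ω k, ‖e ω k‖ ≤ 2 * D := fun ω k =>
    (norm_sub_le _ _).trans (by
      linarith [htrD ω k, (norm_truncCoeff_le b ν Z (fun i => a i ω) k).trans (htrD ω k)])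
  have hem : ∀ k, Measurable fun ω => e ω k := fun k =>
    (h.measurable_trace k Z).sub (h.measurable_truncCoeff k Z)
  have i3 := hint e hem heD
  have hsub : ∀ ω, weightedMeas (e ω) (fun i => a i ω) =
      weightedMeas (fun k => (measMatrix (fun i => a i ω) k * Z).trace) (fun i => a i ω) -
        weightedMeas (truncCoeff b ν Z fun i => a i ω) (fun i => a i ω) := fun ω => by
    simp only [weightedMeas, he, sub_smul, Finset.sum_sub_distrib]
  have hiso := h.integral_weightedMeas_trace hodd Z i1
  -- In the sesquilinear form each `F_k` becomes a product of two coefficients, so the bias is at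
  -- most `d` single-measurement truncation errors.
  have hbias : ‖∫ ω, weightedMeas (e ω) (fun i => a i ω) ∂P‖ ≤ d * (ν ^ 2 * frobNorm Z / 16) := by
    refine opNorm_le_of_bilinear_le (by positivity) fun u v hu hv => ?_
    rw [← integral_dotProduct_mulVec i3]
    have hgi : ∀ k, Integrable (fun ω => ‖e ω k‖ * (‖fourierCoeff (fun i => a i ω) k u‖ *
        ‖fourierCoeff (fun i => a i ω) k v‖)) P := fun k => by
      refine Integrable.of_bound (((hem k).norm.mul ((h.measurable_fourierCoeff k u).norm.mul
        (h.measurable_fourierCoeff k v).norm)).aestronglyMeasurable)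
        (2 * D * ((b * ∑ i, ‖u i‖) * (b * ∑ i, ‖v i‖))) (Filter.Eventually.of_forall fun ω => ?_)
      rw [Real.norm_of_nonneg (by positivity)]
      gcongr
      · exact heD ω k
      · exact norm_fourierCoeff_le (fun i => h.abs_le i ω) k u
      · exact norm_fourierCoeff_le (fun i => h.abs_le i ω) k v
    have hpt : ∀ ω, ‖star u ⬝ᵥ weightedMeas (e ω) (fun i => a i ω) *ᵥ v‖ ≤
        ∑ k, ‖e ω k‖ * (‖fourierCoeff (fun i => a i ω) k u‖ *
          ‖fourierCoeff (fun i => a i ω) k v‖) := fun ω => by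
      rw [weightedMeas, sum_mulVec, dotProduct_sum]
      refine (norm_sum_le _ _).trans_eq (Finset.sum_congr rfl fun k _ => ?_)
      rw [smul_mulVec, dotProduct_smul, star_dotProduct_measMatrix_mulVec, smul_eq_mul, norm_mul,
        norm_mul, norm_star]
    refine (norm_integral_le_of_norm_le (integrable_finsetSum _ fun k _ => hgi k)
      (Filter.Eventually.of_forall hpt)).trans ?_
    rw [integral_finsetSum _ fun k _ => hgi k]
    refine (Finset.sum_le_sum fun k _ =>
      h.integral_truncation_error_le hb hν hx hZ hZ0 hd k hu.le hv.le).trans_eq ?_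
    simp
  simp_rw [hsub] at hbias
  rw [integral_sub i1 i2, hiso] at hbias
  simp only [truncSummand_eq]
  rw [integral_smul]
  have e2 : (1 / L : ℝ) • (Z + Z.trace • (1 : Matrix (Fin d) (Fin d) ℂ)) =
      (1 / (ν ^ 2 * d * L) : ℝ) • (((ν ^ 2 * d : ℝ) : ℂ) •
        (Z + Z.trace • (1 : Matrix (Fin d) (Fin d) ℂ))) := by
    rw [Complex.coe_smul, smul_smul]
    congr 1
    field_simp
  rw [e2, ← smul_sub, norm_smul, norm_sub_rev, Real.norm_of_nonneg (by positivity)]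
  refine (mul_le_mul_of_nonneg_left hbias (by positivity)).trans_eq ?_
  field_simp

end Final

end CodedDiffraction

namespace CodedDiffraction

/-! ### Assembling the tail bound -/

section Tail

open Matrix
open scoped Matrix.Norms.L2Operator

variable {d L : ℕ} {Ω : Type*} [MeasurableSpace Ω] {P : Measure Ω} [IsProbabilityMeasure P]
  {b ν : ℝ} {x : Fin d → ℂ} {Z : Matrix (Fin d) (Fin d) ℂ}

/-- The deviation of the truncated measurement operator, for masks that are bounded everywhere. -/
theorem measureReal_truncOperator_ge_le {ε : Fin L → Fin d → Ω → ℝ} (hb : 0 < b) (hν : 0 < ν)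
    (hε : ∀ l, IsPattern P b ν (ε l)) (hind : iIndepFun (fun p : Fin L × Fin d => ε p.1 p.2) P)
    (hx : ∑ i, ‖x i‖ ^ 2 = 1) (hZ : Z ∈ tangentSpace x) (hZ0 : Z ≠ 0) (hd : 3 ≤ d) (hodd : Odd d)
    (hL : 1 ≤ L) {t : ℝ} (ht : 1 / 4 ≤ t) :
    P.real {ω | t * frobNorm Z ≤ opNorm (projTPerp x
        (truncOperator b ν Z (fun l i => ε l i ω) Z - Z.trace • 1))} ≤
      d * Real.exp (-(t * ν ^ 4 * L /
        (165150720 * b ^ 8 * truncRate b ν * Real.log d))) := by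
  have hT := frobNorm_pos hZ0
  have hL0 : (0 : ℝ) < L := by positivity
  have hd0 : (0 : ℝ) < d := by positivity
  have : Nonempty (Fin d) := ⟨⟨0, by omega⟩⟩
  have h2ν : 2 * ν ≤ b ^ 2 := (hε ⟨0, by omega⟩).two_mul_le hν ⟨0, by omega⟩
  have hγ := truncRate_ge hν h2ν
  have hlog := one_le_log hd
  set T := frobNorm Z with hTdef
  set G : ℝ := truncRate b ν * Real.log d with hG
  have hG9 : 9 ≤ G := by nlinarith
  have hG0 : 0 < G := by linarith
  set Y : Fin L → Ω → Matrix (Fin d) (Fin d) ℂ :=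
    fun l ω => truncSummand L b ν Z (fun i => ε l i ω) Z with hY
  set Q : ℝ := ν ^ 4 * L / (b ^ 8 * G) with hQ
  have hQ0 : 0 < Q := by positivity
  have hqe : t * ν ^ 4 * L / (165150720 * b ^ 8 * truncRate b ν * Real.log d) =
      t * Q / 165150720 := by
    rw [hQ, hG]; field_simp
  rw [hqe]
  -- If the claimed bound is below 1, then, as `d ≥ 3`, the exponential is below `1/2`; half of the
  -- Bernstein exponent then pays for its prefactor 2.
  by_cases htriv : 1 ≤ d * Real.exp (-(t * Q / 165150720))
  · exact measureReal_le_one.trans htriv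
  have hlarge : Real.log 2 ≤ t * Q / 165150720 := by
    by_contra! hcon
    refine htriv ?_
    have h1 : (2 : ℝ)⁻¹ ≤ Real.exp (-(t * Q / 165150720)) := by
      rw [← Real.exp_log (two_pos : (0 : ℝ) < 2), ← Real.exp_neg]
      exact Real.exp_le_exp.2 (neg_le_neg hcon.le)
    have h3 : (3 : ℝ) ≤ d := by exact_mod_cast hd
    nlinarith
  -- the mean of the truncated operator
  have hmean : ‖∑ l, ((∫ ω, Y l ω ∂P) -
      (1 / L : ℝ) • (Z + Z.trace • (1 : Matrix (Fin d) (Fin d) ℂ)))‖ ≤ T / 16 := by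
    refine (norm_sum_le _ _).trans ((Finset.sum_le_sum fun l _ =>
      (hε l).norm_integral_truncSummand_sub_le hb hν hx hZ hZ0 hd hodd hL).trans_eq ?_)
    rw [Finset.sum_const, Finset.card_univ, Fintype.card_fin, nsmul_eq_mul, ← hTdef]
    field_simp
  -- The bias `T/16` is at most `tT/4` because `t ≥ 1/4`, so at least `tT/2` is left to the
  -- fluctuation.
  have hsub : {ω | t * T ≤ opNorm (projTPerp x
        (truncOperator b ν Z (fun l i => ε l i ω) Z - Z.trace • 1))} ⊆
      {ω | t / 2 * T ≤ ‖∑ l, (Y l ω - ∫ ω, Y l ω ∂P)‖} := fun ω hω => by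
    simp only [Set.mem_ofPred_eq] at hω ⊢
    have e : truncOperator b ν Z (fun l i => ε l i ω) Z - Z.trace • 1 =
        (∑ l, (Y l ω - ∫ ω, Y l ω ∂P) + ∑ l, ((∫ ω, Y l ω ∂P) -
          (1 / L : ℝ) • (Z + Z.trace • (1 : Matrix (Fin d) (Fin d) ℂ)))) + Z := by
      have h1 : ∑ _l : Fin L, (1 / L : ℝ) • (Z + Z.trace • (1 : Matrix (Fin d) (Fin d) ℂ)) =
          Z + Z.trace • 1 := by
        rw [Finset.sum_const, Finset.card_univ, Fintype.card_fin, ← Nat.cast_smul_eq_nsmul ℝ,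
          smul_smul, mul_one_div_cancel hL0.ne', one_smul]
      rw [← Finset.sum_add_distrib]
      simp only [sub_add_sub_cancel]
      rw [Finset.sum_sub_distrib, h1, truncOperator]
      simp only [hY]
      abel
    rw [e, projTPerp_add, projTPerp_of_mem_tangentSpace hx hZ, add_zero] at hω
    have h2 := hω.trans ((norm_projTPerp_le hx _).trans (norm_add_le _ _))
    nlinarith
  -- The `G` in `Q` cancels the one in the norm bound, so `2θB ≤ 1` follows from `ν ≤ b²`. Since
  -- `20643840 = 4 * 5160960`, four times the variance constant, the quadratic term is at most half
  -- the linear one.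
  set θ : ℝ := Q / (20643840 * T) with hθ
  have hθ0 : 0 < θ := by positivity
  have hbern := measureReal_norm_sum_sub_integral_ge_le (P := P) (Y := Y)
    (B := 3 * b ^ 4 * G * T / (ν ^ 2 * L)) (V := 2 * 2580480 * b ^ 8 * T ^ 2 / (ν ^ 4 * L ^ 2))
    (θ := θ) (by positivity) hθ0.le
    (fun l => (measurable_truncSummand L b ν Z).comp (measurable_pi_lambda _ (hε l).measurable))
    ((iIndepFun_rows (fun l i => (hε l).measurable i) hind).comp
      (fun _ m => truncSummand L b ν Z m Z) fun _ => measurable_truncSummand L b ν Z)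
    (fun l ω => truncSummand_isHermitian hZ L _)
    (fun l ω => norm_truncSummand_le hb hν (by linarith) hd hL fun i => (hε l).abs_le i ω)
    (fun l u => (hε l).integral_truncSummand_mulVec_le hb hν hx hZ hZ0 hd hL u)
    (by
      have e : 2 * θ * (3 * b ^ 4 * G * T / (ν ^ 2 * L)) = 6 / 20643840 * (ν ^ 2 / b ^ 4) := by
        rw [hθ, hQ]; field_simp; norm_num
      have h1 : ν ^ 2 / b ^ 4 ≤ 1 := by
        rw [div_le_one (by positivity)]
        nlinarith
      rw [e]
      linarith)
    (t / 2 * T)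
  refine (measureReal_mono hsub).trans (hbern.trans ?_)
  rw [Fintype.card_fin, Fintype.card_fin]
  have hexp : L * (θ ^ 2 * (2 * 2580480 * b ^ 8 * T ^ 2 / (ν ^ 4 * L ^ 2))) - θ * (t / 2 * T) ≤
      -(2 * (t * Q / 165150720)) := by
    have e1 : L * (θ ^ 2 * (2 * 2580480 * b ^ 8 * T ^ 2 / (ν ^ 4 * L ^ 2))) =
        Q / G / 82575360 := by
      rw [hθ, hQ]; field_simp; norm_num
    have e2 : θ * (t / 2 * T) = t * Q / 41287680 := by
      rw [hθ]; field_simp; norm_num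
    -- This is `1/G ≤ 1/9 ≤ 1/4 ≤ t`; it makes the exponent linear in `t`.
    have h1 : Q / G ≤ t * Q := by
      rw [div_le_iff₀ hG0]
      nlinarith [mul_pos hQ0 hG0]
    rw [e1, e2]
    linarith [mul_pos (by linarith : 0 < t) hQ0]
  have h2 : 2 * Real.exp (-(2 * (t * Q / 165150720))) ≤ Real.exp (-(t * Q / 165150720)) := by
    rw [← Real.exp_log (two_pos : (0 : ℝ) < 2), ← Real.exp_add, Real.exp_log two_pos]
    exact Real.exp_le_exp.2 (by linarith)
  calc _ ≤ 2 * d * Real.exp (-(2 * (t * Q / 165150720))) := by gcongr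
    _ = d * (2 * Real.exp (-(2 * (t * Q / 165150720)))) := by ring
    _ ≤ _ := by gcongr

end Tail

/-! ### Reduction to masks bounded everywhere -/

/-- A random variable that is bounded almost surely agrees almost surely with a measurable
function that is bounded everywhere. -/
theorem exists_measurable_abs_le {Ω : Type*} [MeasurableSpace Ω] {P : Measure Ω} {f : Ω → ℝ} {b : ℝ}
    (hf : AEMeasurable f P) (hb : 0 ≤ b) (h : ∀ᵐ ω ∂P, |f ω| ≤ b) :
    ∃ g : Ω → ℝ, Measurable g ∧ (∀ ω, |g ω| ≤ b) ∧ f =ᵐ[P] g := by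
  refine ⟨fun ω => max (-b) (min b (hf.mk f ω)),
    measurable_const.max (measurable_const.min hf.measurable_mk), fun ω => ?_, ?_⟩
  · rw [abs_le]
    exact ⟨le_max_left _ _, max_le (by linarith) (min_le_left _ _)⟩
  · filter_upwards [h, hf.ae_eq_mk] with ω h1 h2
    rw [← h2]
    obtain ⟨h3, h4⟩ := abs_le.1 h1
    rw [min_eq_right h4, max_eq_right h3]

end CodedDiffraction

theorem proposition3 :
    ∃ C₂ : ℝ, 0 < C₂ ∧
      ∀ (d L : ℕ), 3 ≤ d → Odd d → 1 ≤ L →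
      -- the real random variable `ξ` behind the masks, its a priori bound `b`, its variance `ν`
      ∀ (Ω₀ : Type*) [MeasurableSpace Ω₀] (P₀ : Measure Ω₀) [IsProbabilityMeasure P₀]
        (ξ : Ω₀ → ℝ) (b ν : ℝ),
        AEMeasurable ξ P₀ → 0 < b → (∀ᵐ ω ∂P₀, |ξ ω| ≤ b) →
        (∫ ω, ξ ω ∂P₀) = 0 → (∫ ω, ξ ω ^ 3 ∂P₀) = 0 →
        ν = (∫ ω, ξ ω ^ 2 ∂P₀) → 0 < ν → (∫ ω, ξ ω ^ 4 ∂P₀) = 2 * ν ^ 2 →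
      -- the entries of the `L` modulation patterns are independent copies of `ξ`
      ∀ (Ω : Type*) [MeasurableSpace Ω] (P : Measure Ω) [IsProbabilityMeasure P]
        (ε : Fin L → Fin d → Ω → ℝ),
        (∀ l i, IdentDistrib (ε l i) ξ P P₀) →
        iIndepFun (fun p : Fin L × Fin d => ε p.1 p.2) P →
      ∀ x : Fin d → ℂ, ∑ i, ‖x i‖ ^ 2 = 1 →
      ∀ Z ∈ CodedDiffraction.tangentSpace x, Z ≠ 0 →
      ∀ t : ℝ, 1 / 4 ≤ t →
        P.real {ω | t * CodedDiffraction.frobNorm Z ≤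
            CodedDiffraction.opNorm (CodedDiffraction.projTPerp x
              (CodedDiffraction.truncOperator b ν Z (fun l i => ε l i ω) Z -
                Z.trace • (1 : Matrix (Fin d) (Fin d) ℂ)))} ≤
          d * Real.exp (-(t * ν ^ 4 * L /
            (C₂ * b ^ 8 * CodedDiffraction.truncRate b ν * Real.log d))) := by 
  refine ⟨165150720, by norm_num, ?_⟩
  intro d L hd hodd hL Ω₀ _ P₀ _ ξ b ν hξ hb hbd h1 h3 h2 hν h4 Ω _ P _ ε hid hind x hx Z hZ hZ0 t ht
  have hbε : ∀ l i, ∀ᵐ ω ∂P, |ε l i ω| ≤ b := fun l i =>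
    (hid l i).symm.ae_snd (p := fun y => |y| ≤ b) (measurableSet_le measurable_id.abs measurable_const)
      hbd
  -- The masks are modified on a null set to be measurable and bounded everywhere; moments,
  -- independence and the probability of the event are unaffected.
  choose ε' hm hb' hae using fun l i =>
    CodedDiffraction.exists_measurable_abs_le (hid l i).aemeasurable_fst hb.le (hbε l i)
  have hmom : ∀ (m : ℕ) l i, ∫ ω, ε' l i ω ^ m ∂P = ∫ ω, ξ ω ^ m ∂P₀ := fun m l i => by
    have e : ∫ ω, ε l i ω ^ m ∂P = ∫ ω, ξ ω ^ m ∂P₀ :=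
      ((hid l i).comp (u := fun y => y ^ m) (by fun_prop)).integral_eq
    rw [← e]
    exact integral_congr_ae ((hae l i).mono fun ω hω => by simp only [hω])
  have hind' : iIndepFun (fun p : Fin L × Fin d => ε' p.1 p.2) P :=
    hind.congr fun p => hae p.1 p.2
  have hpat : ∀ l, CodedDiffraction.IsPattern P b ν (ε' l) := fun l =>
    { measurable := hm l
      abs_le := hb' l
      indep := hind'.precomp (g := fun i => (l, i)) fun _ _ hij => (Prod.mk.inj hij).2
      mean := fun i => by
        have := hmom 1 l i
        simp only [pow_one] at this
        rw [this, h1]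
      second := fun i => by rw [hmom, h2]
      fourth := fun i => by rw [hmom, h4] }
  have hall : ∀ᵐ ω ∂P, ∀ l i, ε l i ω = ε' l i ω :=
    ae_all_iff.2 fun l => ae_all_iff.2 fun i => hae l i
  refine le_trans (le_of_eq (measureReal_congr ?_))
    (CodedDiffraction.measureReal_truncOperator_ge_le hb hν hpat hind' hx hZ hZ0 hd hodd hL ht)
  filter_upwards [hall] with ω hω
  have : (fun l i => ε l i ω) = fun l i => ε' l i ω := by
    ext l i
    exact hω l i
  exact congrArg (fun m => t * CodedDiffraction.frobNorm Z ≤ CodedDiffraction.opNorm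
    (CodedDiffraction.projTPerp x (CodedDiffraction.truncOperator b ν Z m Z - Z.trace • 1))) this
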